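/- Let $X$ be a countable set, $m\colon X\to(0,\infty)$, and let $b\colon X\times X\to[0,\infty)$ satisfy $b(x,y)=b(y,x)$, $b(x,x)=0$ and $\sum_{y}b(x,y)<\infty$ for all $x,y\in X$; $b$ is called a graph over $(X,m)$ (without killing term). Suppose $b$ is connected, i.e. any $x,y\in X$ are joined by a finite sequence of vertices $x=x_0,\dots,x_n=y$ with $b(x_{i},x_{i+1})>0$ for all $i<n$. For $f,g\colon X\to\mathbb R$ of finite energy, i.e. $\sum_{x,y}b(x,y)(f(x)-f(y))^2<\infty$ and likewise for $g$, let $\mathcal Q(f,g)=\tfrac12\sum_{x,y\in X}b(x,y)(f(x)-f(y))(g(x)-g(y))$. Let $Q^{(D)}$ be the restriction of $\mathcal Q$ to the closure of the finitely supported functions with respect to the norm $(\mathcal Q(f,f)+\|f\|_{\ell^2(X,m)}^2)^{1/2}$, let $L^{(D)}$ be the nonnegative self-adjoint operator on the real Hilbert space $\ell^2(X,m)$ associated with $Q^{(D)}$, and let $P^{(D)}_t=e^{-tL^{(D)}}$ for $t>0$ be the Dirichlet semigroup, extended in the usual way to all $\ell^p(X,m)$, $1\le p\le\infty$, by $P^{(D)}_tf(x)=\sum_{y}f(y)\,P^{(D)}_t1_{\{y\}}(x)$.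 The graph is called stochastically complete if $P^{(D)}_s1=1$ for some $s>0$, equivalently for all $s>0$. Let $(X_k)_{k\ge0}$ be an exhaustion: finite sets $X_k\subseteq X_{k+1}$ with $\bigcup_kX_k=X$ such that the restriction of $b$ to $X_k\times X_k$ is a connected graph for every $k$. Let $$L_k^{(N)}f(x)=\frac1{m(x)}\sum_{y\in X_k}b(x,y)(f(x)-f(y)),\qquad x\in X_k,\ f\colon X_k\to\mathbb R,$$ and let $P^{(N)}_{t,k}=e^{-tL^{(N)}_k}$ be the Neumann-restricted semigroups, regarded as operators on functions on $X$ by restricting to $X_k$ and extending by $0$. Fix $t>0$. Then the following statements are equivalent: 1. The graph $b$ over $(X,m)$ is stochastically complete, in the form $P^{(D)}_s1=1$ for all $s>0$. 2. $P^{(D)}_s1=1$ for some $s>0$. 3. $P^{(N)}_{t,k}\to P^{(D)}_t$ strongly in $\ell^1(X,m)$ as $k\to\infty$, that is, $\|P^{(N)}_{t,k}f-P^{(D)}_tf\|_{1}\to0$ for every $f\in\ell^1(X,m)$, where $\|f\|_1=\sum_x|f(x)|m(x)$. -/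

import Mathlib

open MeasureTheory Filter Topology
open scoped ENNReal

noncomputable section

/-- A graph `b` (with killing term `c = 0`) over the discrete measure space `(X, m)`. -/
structure WeightedGraph (X : Type*) where
  /-- the vertex measure -/
  m : X → ℝ
  m_pos : ∀ x, 0 < m x
  /-- the edge weights -/
  b : X → X → ℝ
  b_nonneg : ∀ x y, 0 ≤ b x y
  b_symm : ∀ x y, b x y = b y x
  b_self : ∀ x, b x x = 0
  b_summable : ∀ x, Summable (b x)

namespace WeightedGraph

/-- Any two vertices are joined by a finite path along which `b` is positive. -/
def Connected {X : Type*} (G : WeightedGraph X) : Prop :=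
  ∀ x y, Relation.ReflTransGen (fun u v => 0 < G.b u v) x y

/-- The graph induced on a finite set of vertices: `b` and `m` are restricted. -/
def induce {X : Type*} (G : WeightedGraph X) (S : Finset X) : WeightedGraph S where
  m x := G.m x
  m_pos x := G.m_pos x
  b x y := G.b x y
  b_nonneg x y := G.b_nonneg x y
  b_symm x y := G.b_symm x y
  b_self x := G.b_self x
  b_summable x := (G.b_summable x).comp_injective Subtype.val_injective

/-- An exhaustion: an increasing sequence of finite sets with union `X` whose induced graphs
are connected. -/
structure IsExhaustion {X : Type*} (G : WeightedGraph X) (K : ℕ → Finset X) : Prop where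
  mono : ∀ k, K k ⊆ K (k + 1)
  exhausts : ∀ x, ∃ k, x ∈ K k
  connected : ∀ k, (G.induce (K k)).Connected

/-! ### The Neumann restrictions of the semigroup -/

/-- The Laplacian of a finite graph, `L f x = (1 / m x) ∑ y, b x y (f x - f y)`. -/
def finiteLaplacian {V : Type*} [Fintype V] (G : WeightedGraph V) : (V → ℝ) →ₗ[ℝ] (V → ℝ) where
  toFun f x := 1 / G.m x * ∑ y, G.b x y * (f x - f y)
  map_add' f g := by
    funext x
    simp only [Pi.add_apply]
    rw [← mul_add, ← Finset.sum_add_distrib]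
    congr 1
    exact Finset.sum_congr rfl fun y _ => by ring
  map_smul' r f := by
    funext x
    simp only [Pi.smul_apply, smul_eq_mul, RingHom.id_apply, Finset.mul_sum]
    exact Finset.sum_congr rfl fun y _ => by ring

/-- The Neumann restriction of the semigroup to the finite set `S`: restrict `f` to `S`, apply
`exp (-t L)` with `L` the Laplacian of the graph induced on `S`, and extend by zero. -/
def neumannRestriction {X : Type*} (G : WeightedGraph X) (S : Finset X) (t : ℝ) (f : X → ℝ) :
    X → ℝ :=
  open Classical in
  fun x =>
    if hx : x ∈ S then
      NormedSpace.exp (-t • LinearMap.toContinuousLinearMap (G.induce S).finiteLaplacian)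
        (fun y : S => f y) ⟨x, hx⟩
    else 0

/-! ### The Dirichlet form, the Dirichlet Laplacian and its semigroup -/

/-- The measure on `X` with mass `m x` at each point `x`. -/
def measure {X : Type*} [MeasurableSpace X] (G : WeightedGraph X) : Measure X :=
  Measure.sum fun x => ENNReal.ofReal (G.m x) • Measure.dirac x

theorem measure_singleton {X : Type*} [MeasurableSpace X] [DiscreteMeasurableSpace X]
    (G : WeightedGraph X) (x : X) : G.measure {x} = ENNReal.ofReal (G.m x) := by
  classical
  rw [measure, Measure.sum_apply _ (MeasurableSet.of_discrete), tsum_eq_single x]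
  · simp
  · intro y hy
    simp [hy]

/-- The real Hilbert space `ℓ²(X, m)`. Points have positive mass, so its elements are functions. -/
abbrev ell2 {X : Type*} [MeasurableSpace X] (G : WeightedGraph X) : Type _ :=
  Lp ℝ 2 G.measure

/-- The quadratic energy `𝒬(f) = (1/2) ∑_{x,y} b x y (f x - f y)²`, with values in `[0, ∞]`. -/
def energy {X : Type*} (G : WeightedGraph X) (f : X → ℝ) : ℝ≥0∞ :=
  (1 / 2) * ∑' x, ∑' y, ENNReal.ofReal (G.b x y * (f x - f y) ^ 2)

/-- The bilinear energy form `𝒬(f, g) = (1/2) ∑_{x,y} b x y (f x - f y) (g x - g y)`; the series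
converges absolutely when `f` and `g` have finite energy. -/
def energyForm {X : Type*} (G : WeightedGraph X) (f g : X → ℝ) : ℝ :=
  (1 / 2) * ∑' p : X × X, G.b p.1 p.2 * (f p.1 - f p.2) * (g p.1 - g p.2)

/-- The form domain `D(Q^(D))`: the closure of the finitely supported functions with respect to
`‖f‖_𝒬² = 𝒬(f) + ‖f‖²`. -/
def dirichletDomain {X : Type*} [MeasurableSpace X] (G : WeightedGraph X) : Set G.ell2 :=
  {f | ∀ ε : ℝ≥0∞, 0 < ε → ∃ φ : G.ell2, (Function.support φ).Finite ∧
    G.energy (f - φ : G.ell2) + ‖f - φ‖ₑ ^ 2 < ε}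

/-- `f` lies in the domain of the Dirichlet Laplacian `L^(D)` and `L^(D) f = g`, where `L^(D)` is
the operator of the form `Q^(D)`, the restriction of `𝒬` to `D(Q^(D))`. -/
def IsDirichletLaplacian {X : Type*} [MeasurableSpace X] (G : WeightedGraph X)
    (f g : G.ell2) : Prop :=
  f ∈ G.dirichletDomain ∧ ∀ v ∈ G.dirichletDomain, G.energyForm f v = inner ℝ g v

open Classical in
/-- The resolvent `(L^(D) + α)⁻¹` (for `α > 0`), the bounded operator `R` on `ℓ²(X, m)` for which
`R f` lies in the domain of `L^(D)` and `L^(D) (R f) + α R f = f` for every `f`. There is exactly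
one such operator, as `L^(D)` is self-adjoint and nonnegative. -/
def dirichletResolvent {X : Type*} [MeasurableSpace X] (G : WeightedGraph X) (α : ℝ) :
    G.ell2 →L[ℝ] G.ell2 :=
  if h : ∃ R : G.ell2 →L[ℝ] G.ell2, ∀ f, G.IsDirichletLaplacian (R f) (f - α • R f) then
    h.choose
  else 0

/-- The Yosida approximation `α L^(D) (L^(D) + α)⁻¹ = α (1 - α (L^(D) + α)⁻¹)` of `L^(D)`. -/
def dirichletYosida {X : Type*} [MeasurableSpace X] (G : WeightedGraph X) (α : ℝ) :
    G.ell2 →L[ℝ] G.ell2 :=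
  α • (1 - α • G.dirichletResolvent α)

/-- The Dirichlet semigroup `exp (-t L^(D))` on `ℓ²(X, m)`, constructed as in the Hille–Yosida
theorem: the strong limit of `exp (-t L_α)` as `α → ∞`, with `L_α` the Yosida approximation. -/
def dirichletSemigroupL2 {X : Type*} [MeasurableSpace X] (G : WeightedGraph X) (t : ℝ)
    (f : G.ell2) : G.ell2 :=
  limUnder atTop fun α : ℝ => NormedSpace.exp (-t • G.dirichletYosida α) f

/-- The indicator function of the vertex `x` in `ℓ²(X, m)`. -/
def delta {X : Type*} [MeasurableSpace X] [DiscreteMeasurableSpace X] (G : WeightedGraph X)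
    (x : X) : G.ell2 :=
  indicatorConstLp 2 (MeasurableSet.of_discrete (s := {x}))
    (by rw [G.measure_singleton]; exact ENNReal.ofReal_ne_top) (1 : ℝ)

/-- The extension of the Dirichlet semigroup to `ℓ^p(X, m)`, `1 ≤ p ≤ ∞`, through its kernel:
`P_t f x = ∑ y, f y (P_t 1_y) x`, that is, `P_t f` is the pointwise limit of `P_t (f 1_K)` along the
finite sets `K`. The series converges absolutely for `f` in any `ℓ^p(X, m)`. -/
def dirichletSemigroup {X : Type*} [MeasurableSpace X] [DiscreteMeasurableSpace X]
    (G : WeightedGraph X) (t : ℝ) (f : X → ℝ) : X → ℝ :=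
  fun x => ∑' y, f y * G.dirichletSemigroupL2 t (G.delta y) x

end WeightedGraph

end

/-! ### Exponentials of bounded operators -/

namespace ContractionSemigroup

section Exp

variable {E : Type*} [NormedAddCommGroup E] [NormedSpace ℝ E]

/-! Mass is what decides the matter. A Neumann restriction on a finite set preserves the total mass
`∑ m f`, whereas by symmetry of the heat kernel the total mass of `P_t 1_y` is `m y * (P_t 1) y`. An
`ℓ¹` limit of functions of mass `m y` has norm at least `m y`, so convergence at the time `t` forces
`P_t 1 = 1` (`dirichletSemigroup_one_of_tendsto`). The Chapman–Kolmogorov identity carries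
conservation from one time to all times (`tsum_heat_eq_one_of_exists`).

For the converse it suffices that the Neumann kernels are asymptotically at least the Dirichlet
kernel at every point (`eventually_le_neumannRestriction`). Since the masses are equal, Scheffé's
argument turns this lower bound into `ℓ¹` convergence on the indicators `1_y`, and dominated
convergence extends it to all of `ℓ¹`.

The lower bound is obtained through resolvents. The resolvent `R_α` of the form is read off from the
orthogonal projection onto the closed graph of the gradient. These graphs increase along the
exhaustion, so the resolvents of the finite Dirichlet restrictions converge strongly
(`tendsto_formResolvent`). On a finite set the Dirichlet operator is the Neumann operator plus a
nonnegative killing rate, so the minimum principle makes its resolvent the smaller one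
(`formResolvent_finset_le`). A Yosida semigroup is a Poisson average of powers of `α R_α`, hence
inherits both facts. Finally, `l1Seminorm_exp_sub_exp_yosida_le` bounds the `ℓ¹` distance between a
Neumann semigroup and its Yosida approximation on `1_y`; the bound becomes independent of the finite
set in `yosidaError` and vanishes as `α → ∞`. Hence `α` can be fixed before letting the sets grow.
-/

theorem norm_pow_apply_le {T : E →L[ℝ] E} (hT : ∀ f, ‖T f‖ ≤ ‖f‖) (n : ℕ) (f : E) :
    ‖(T ^ n) f‖ ≤ ‖f‖ := by
  induction n with
  | zero => simp
  | succ n ih => rw [pow_succ']; exact (hT _).trans ih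

/-- Telescoping: each exchange of a factor `S` for a factor `T` costs at most `p (S f - T f)`. A
general seminorm is allowed because the estimate is needed both in the norm of `ℓ²` and in `ℓ¹`. -/
theorem seminorm_pow_sub_pow_le (p : Seminorm ℝ E) {S T : E →L[ℝ] E} (hc : Commute S T)
    (hS : ∀ f, p (S f) ≤ p f) (hT : ∀ f, p (T f) ≤ p f) (n : ℕ) (f : E) :
    p ((S ^ n) f - (T ^ n) f) ≤ n * p (S f - T f) := by
  have hSn : ∀ (n : ℕ) g, p ((S ^ n) g) ≤ p g := fun n g => by
    induction n with
    | zero => simp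
    | succ n ih => rw [pow_succ']; exact (hS _).trans ih
  induction n with
  | zero => simp
  | succ n ih =>
    have h : (S ^ (n + 1)) f - (T ^ (n + 1)) f =
        (S ^ n) (S f - T f) + T ((S ^ n) f - (T ^ n) f) := by
      have h1 : (S ^ n) (T f) = T ((S ^ n) f) := congrArg (· f) (hc.pow_left n).eq
      rw [map_sub, map_sub, h1, pow_succ, pow_succ' T]
      change (S ^ n) (S f) - T ((T ^ n) f) = _
      abel
    rw [h]
    calc _ ≤ p ((S ^ n) (S f - T f)) + p (T ((S ^ n) f - (T ^ n) f)) := map_add_le_add p _ _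
      _ ≤ p (S f - T f) + n * p (S f - T f) := add_le_add (hSn n _) ((hT _).trans ih)
      _ = _ := by push_cast; ring

/-- A contractive resolvent family converges strongly to the identity on the closure of its
range. -/
theorem tendsto_smul_resolvent_apply {R : ℝ → E →L[ℝ] E}
    (hres : ∀ α β : ℝ, 0 < α → 0 < β → ∀ f, R α f = R β f + (β - α) • R β (R α f))
    (hR : ∀ α : ℝ, 0 < α → ∀ f, ‖(α • R α) f‖ ≤ ‖f‖) (hd : DenseRange (R 1)) (f : E) :
    Tendsto (fun α => (α • R α) f) atTop (𝓝 f) := by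
  rw [Metric.tendsto_nhds]
  intro ε hε
  obtain ⟨h, hh⟩ := hd.exists_dist_lt f (ε := ε / 3) (by positivity)
  have hlim : Tendsto (fun α : ℝ => α⁻¹ * ‖h - R 1 h‖) atTop (𝓝 0) := by
    simpa using tendsto_inv_atTop_zero.mul_const ‖h - R 1 h‖
  filter_upwards [eventually_gt_atTop 0,
    hlim.eventually_lt_const (show (0 : ℝ) < ε / 3 by positivity)] with α hα hs
  -- By the resolvent identity, the error on the range of `R 1` is of order `1 / α`.
  have e1 : (α • R α) (R 1 h) - R 1 h = -(α⁻¹ • (α • R α) (h - R 1 h)) := by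
    have := hres 1 α one_pos hα h
    rw [smul_apply, smul_apply, inv_smul_smul₀ hα.ne', map_sub]
    rw [sub_smul, one_smul] at this
    nth_rewrite 2 [this]
    abel
  have e2 : ‖(α • R α) (R 1 h) - R 1 h‖ < ε / 3 := by
    rw [e1, norm_neg, norm_smul, Real.norm_of_nonneg (by positivity)]
    exact (mul_le_mul_of_nonneg_left (hR α hα _) (by positivity)).trans_lt hs
  rw [dist_eq_norm] at hh ⊢
  have e3 : (α • R α) f - f = (α • R α) (f - R 1 h) + ((α • R α) (R 1 h) - R 1 h) - (f - R 1 h) := by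
    rw [map_sub]; abel
  rw [e3]
  calc _ ≤ ‖(α • R α) (f - R 1 h)‖ + ‖(α • R α) (R 1 h) - R 1 h‖ + ‖f - R 1 h‖ :=
        (norm_sub_le _ _).trans (add_le_add_left (norm_add_le _ _) _)
    _ < ε := by linarith [hR α hα (f - R 1 h)]

variable [CompleteSpace E]

theorem hasSum_exp_apply (T : E →L[ℝ] E) (f : E) :
    HasSum (fun n : ℕ => ((n.factorial : ℝ)⁻¹) • (T ^ n) f) (NormedSpace.exp T f) := by
  have h := NormedSpace.exp_series_hasSum_exp' (𝕂 := ℝ) T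
  exact h.mapL (ContinuousLinearMap.apply ℝ E f)

theorem hasSum_exp_smul_apply (c : ℝ) (T : E →L[ℝ] E) (f : E) :
    HasSum (fun n : ℕ => (c ^ n / n.factorial) • (T ^ n) f) (NormedSpace.exp (c • T) f) := by
  convert hasSum_exp_apply (c • T) f using 2 with n
  rw [smul_pow, smul_apply, smul_smul, div_eq_inv_mul]

theorem exp_add_smul (A : E →L[ℝ] E) (s t : ℝ) :
    NormedSpace.exp ((s + t) • A) = NormedSpace.exp (s • A) * NormedSpace.exp (t • A) := by
  let : NormedAlgebra ℚ (E →L[ℝ] E) := NormedAlgebra.restrictScalars ℚ ℝ _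
  rw [add_smul, NormedSpace.exp_add_of_commute]
  exact ((Commute.refl A).smul_left s).smul_right t

theorem exp_add_scalar (c : ℝ) (T : E →L[ℝ] E) :
    NormedSpace.exp (c • (1 : E →L[ℝ] E) + T) = Real.exp c • NormedSpace.exp T := by
  let : NormedAlgebra ℚ (E →L[ℝ] E) := NormedAlgebra.restrictScalars ℚ ℝ _
  rw [NormedSpace.exp_add_of_commute ((Commute.one_left T).smul_left c)]
  have h := NormedSpace.algebraMap_exp_comm (𝕂 := ℝ) (𝔸 := E →L[ℝ] E) c
  rw [Algebra.algebraMap_eq_smul_one, Algebra.algebraMap_eq_smul_one] at h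
  rw [← h, ← Real.exp_eq_exp_ℝ, smul_mul_assoc, one_mul]

/-- The semigroup generated by the Yosida approximation `α (1 - α R)`. -/
theorem exp_yosida (t α : ℝ) (R : E →L[ℝ] E) :
    NormedSpace.exp (-t • (α • (1 - α • R))) =
      Real.exp (-(t * α)) • NormedSpace.exp ((t * α) • (α • R)) := by
  rw [← exp_add_scalar]
  congr 1
  module

/-- The semigroup of a Yosida approximation is a Poisson average of powers of `α R`. -/
theorem hasSum_exp_yosida (t α : ℝ) (R : E →L[ℝ] E) (f : E) :
    HasSum (fun n : ℕ => (Real.exp (-(t * α)) * ((t * α) ^ n / n.factorial)) • ((α • R) ^ n) f)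
      (NormedSpace.exp (-t • (α • (1 - α • R))) f) := by
  rw [exp_yosida, smul_apply]
  convert (hasSum_exp_smul_apply (t * α) (α • R) f).const_smul (Real.exp (-(t * α))) using 2
  rw [smul_smul]

theorem hasSum_poisson (c : ℝ) :
    HasSum (fun n : ℕ => Real.exp (-c) * (c ^ n / n.factorial)) 1 := by
  have h := (NormedSpace.expSeries_div_hasSum_exp (c : ℝ)).mul_left (Real.exp (-c))
  rwa [← Real.exp_eq_exp_ℝ, ← Real.exp_add, neg_add_cancel, Real.exp_zero] at h

theorem norm_exp_yosida_apply_le {t α : ℝ} (ht : 0 ≤ t) (hα : 0 ≤ α) {R : E →L[ℝ] E}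
    (hR : ∀ f, ‖(α • R) f‖ ≤ ‖f‖) (f : E) :
    ‖NormedSpace.exp (-t • (α • (1 - α • R))) f‖ ≤ ‖f‖ := by
  rw [← (hasSum_exp_yosida t α R f).tsum_eq]
  have h := (hasSum_poisson (t * α)).mul_right ‖f‖
  rw [one_mul] at h
  refine tsum_of_norm_bounded h fun n => ?_
  rw [norm_smul, Real.norm_of_nonneg (by positivity)]
  exact mul_le_mul_of_nonneg_left (norm_pow_apply_le hR n f) (by positivity)

/-- Strong convergence of contractions passes to the semigroups of the Yosida approximations. -/
theorem tendsto_exp_yosida_apply {ι : Type*} {l : Filter ι} {t α : ℝ} (ht : 0 ≤ t) (hα : 0 ≤ α)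
    {R : ι → E →L[ℝ] E} {R' : E →L[ℝ] E} (hR : ∀ i f, ‖(α • R i) f‖ ≤ ‖f‖)
    (h : ∀ f, Tendsto (fun i => R i f) l (𝓝 (R' f))) (f : E) :
    Tendsto (fun i => NormedSpace.exp (-t • (α • (1 - α • R i))) f) l
      (𝓝 (NormedSpace.exp (-t • (α • (1 - α • R'))) f)) := by
  simp_rw [← (hasSum_exp_yosida _ _ _ f).tsum_eq]
  have hb := (hasSum_poisson (t * α)).mul_right ‖f‖
  refine tendsto_tsum_of_dominated_convergence hb.summable (fun n => ?_)
    (Eventually.of_forall fun i n => ?_)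
  · refine Tendsto.const_smul ?_ _
    induction n with
    | zero => simpa using tendsto_const_nhds
    | succ n ih =>
      -- The first term is controlled by contractivity uniformly in `i`; in the second, the operator
      -- acts on a vector that no longer depends on `i`.
      have hs : ∀ i, ((α • R i) ^ (n + 1)) f = (α • R i) (((α • R i) ^ n) f - ((α • R') ^ n) f)
          + (α • R i) (((α • R') ^ n) f) := fun i => by
        rw [← map_add, sub_add_cancel, pow_succ']; rfl
      simp_rw [hs]
      rw [pow_succ', ← zero_add ((α • R' * (α • R') ^ n) f)]
      refine Tendsto.add ?_ ((h _).const_smul α)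
      refine squeeze_zero_norm (fun i => hR i _) ?_
      simpa using (ih.sub_const (((α • R') ^ n) f)).norm
  · rw [norm_smul, Real.norm_of_nonneg (by positivity)]
    exact mul_le_mul_of_nonneg_left (norm_pow_apply_le (hR i) n f) (by positivity)

/-- Semigroups generated by commuting operators and contractive for a common seminorm differ by at
most `t` times the difference of the generators. -/
theorem seminorm_exp_sub_exp_le (p : Seminorm ℝ E) (hp : Continuous p) {A B : E →L[ℝ] E}
    (hc : Commute A B) (hA : ∀ s : ℝ, 0 ≤ s → ∀ f, p (NormedSpace.exp (-s • A) f) ≤ p f)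
    (hB : ∀ s : ℝ, 0 ≤ s → ∀ f, p (NormedSpace.exp (-s • B) f) ≤ p f) {t : ℝ} (ht : 0 < t)
    (f : E) :
    p (NormedSpace.exp (-t • A) f - NormedSpace.exp (-t • B) f) ≤ t * p (A f - B f) := by
  let : NormedAlgebra ℚ (E →L[ℝ] E) := NormedAlgebra.restrictScalars ℚ ℝ _
  set φ : ℝ → E := fun s => NormedSpace.exp (s • A) f - NormedSpace.exp (s • B) f with hφ
  have hd : HasDerivAt φ (A f - B f) 0 := by
    have h : ∀ C : E →L[ℝ] E, HasDerivAt (fun s : ℝ => NormedSpace.exp (s • C) f) (C f) 0 :=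
      fun C => by
        have := (hasDerivAt_exp_smul_const (𝕂 := ℝ) C 0).clm_apply (hasDerivAt_const 0 f)
        simpa using this
    exact (h A).sub (h B)
  -- The time `t` is cut into `n + 1` equal steps. Telescoping bounds the difference by `n + 1`
  -- times the error of one step, whose limit is `t` times the seminorm of the derivative at `0`.
  have hu : Tendsto (fun n : ℕ => -t / ((n : ℝ) + 1)) atTop (𝓝[≠] 0) := by
    refine tendsto_nhdsWithin_iff.2 ⟨?_, Eventually.of_forall fun n => ?_⟩
    · have := (tendsto_one_div_add_atTop_nhds_zero_nat (𝕜 := ℝ)).const_mul (-t)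
      simpa [div_eq_mul_inv] using this
    · exact div_ne_zero (by linarith) (by positivity)
  have hl := ((hp.tendsto _).comp (hd.tendsto_slope_zero.comp hu)).const_mul t
  refine ge_of_tendsto' hl fun n => ?_
  have hn : (0 : ℝ) < (n : ℝ) + 1 := by positivity
  have hpow : ∀ C : E →L[ℝ] E, NormedSpace.exp (-t • C) =
      NormedSpace.exp (-(t / ((n : ℝ) + 1)) • C) ^ (n + 1) := fun C => by
    rw [← NormedSpace.exp_nsmul, ← Nat.cast_smul_eq_nsmul ℝ, smul_smul]
    congr 2
    push_cast
    field_simp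
  rw [hpow A, hpow B]
  have hs : 0 ≤ t / ((n : ℝ) + 1) := by positivity
  refine (seminorm_pow_sub_pow_le p ?_ (hA _ hs) (hB _ hs) _ _).trans (le_of_eq ?_)
  · exact ((hc.smul_left _).smul_right _).exp
  · simp only [Function.comp_apply, zero_add, map_smul_eq_mul]
    have h0 : φ 0 = 0 := by simp [hφ]
    rw [h0, sub_zero, hφ]
    simp only [neg_div]
    rw [norm_inv, norm_neg, Real.norm_of_nonneg hs]
    push_cast
    field_simp

/-- The semigroups of the Yosida approximations converge strongly. -/
theorem exists_tendsto_exp_yosida_apply {R : ℝ → E →L[ℝ] E}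
    (hres : ∀ α β : ℝ, 0 < α → 0 < β → ∀ f, R α f = R β f + (β - α) • R β (R α f))
    (hR : ∀ α : ℝ, 0 < α → ∀ f, ‖(α • R α) f‖ ≤ ‖f‖) (hd : DenseRange (R 1)) {t : ℝ} (ht : 0 < t)
    (f : E) :
    ∃ g, Tendsto (fun α => NormedSpace.exp (-t • (α • (1 - α • R α))) f) atTop (𝓝 g) := by
  have hcomm : ∀ α β : ℝ, 0 < α → 0 < β → Commute (R α) (R β) := fun α β hα hβ => by
    rcases eq_or_ne α β with rfl | hne
    · exact Commute.refl _
    · ext f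
      have h1 := hres α β hα hβ f
      have h2 := hres β α hβ hα f
      have h3 : (β - α) • (R α (R β f) - R β (R α f)) = 0 := by
        rw [smul_sub, sub_eq_zero]
        rw [← sub_eq_iff_eq_add'] at h1 h2
        rw [← h1, ← neg_sub α β, neg_smul, ← h2, neg_sub]
      exact sub_eq_zero.1 ((smul_eq_zero.1 h3).resolve_left (sub_ne_zero.2 hne.symm))
  have hcY : ∀ α β : ℝ, 0 < α → 0 < β →
      Commute (α • (1 - α • R α)) (β • (1 - β • R β)) := fun α β hα hβ =>
    (((Commute.one_left _).sub_left ((Commute.one_right _).sub_right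
      (((hcomm α β hα hβ).smul_right β).smul_left α))).smul_left α).smul_right β
  have hY : ∀ α : ℝ, 0 < α → ∀ s : ℝ, 0 ≤ s → ∀ g,
      ‖NormedSpace.exp (-s • (α • (1 - α • R α))) g‖ ≤ ‖g‖ := fun α hα s hs g =>
    norm_exp_yosida_apply_le hs hα.le (hR α hα) g
  refine cauchySeq_tendsto_of_complete (Metric.cauchySeq_iff.2 fun ε hε => ?_)
  obtain ⟨h, hh⟩ := hd.exists_dist_lt f (ε := ε / 3) (by positivity)
  rw [dist_eq_norm] at hh
  have hk := (tendsto_smul_resolvent_apply hres hR hd (h - R 1 h)).cauchySeq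
  obtain ⟨N, hN⟩ := Metric.cauchySeq_iff.1 hk (ε / 3 / t) (by positivity)
  refine ⟨max N 1, fun α hα β hβ => ?_⟩
  have hα0 : 0 < α := one_pos.trans_le ((le_max_right _ _).trans hα)
  have hβ0 : 0 < β := one_pos.trans_le ((le_max_right _ _).trans hβ)
  -- On the range of `R 1` the Yosida approximations themselves converge, because `γ R γ` tends
  -- strongly to the identity. The difference of the semigroups there is at most `t` times that of
  -- the generators.
  have hg : ∀ γ : ℝ, 0 < γ → (γ • (1 - γ • R γ)) (R 1 h) = (γ • R γ) (h - R 1 h) := fun γ hγ => by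
    have := hres 1 γ one_pos hγ h
    rw [smul_apply, smul_apply, map_sub]
    congr 1
    simp only [_root_.sub_apply, smul_apply, one_apply_eq_self]
    rw [sub_smul, one_smul] at this
    nth_rewrite 1 [this]
    abel
  have key := seminorm_exp_sub_exp_le (normSeminorm ℝ E) continuous_norm (hcY α β hα0 hβ0)
    (hY α hα0) (hY β hβ0) ht (R 1 h)
  rw [hg α hα0, hg β hβ0] at key
  have hNab := hN α ((le_max_left _ _).trans hα) β ((le_max_left _ _).trans hβ)
  rw [dist_eq_norm, lt_div_iff₀ ht] at hNab
  rw [dist_eq_norm]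
  set S := NormedSpace.exp (-t • (α • (1 - α • R α)))
  set T := NormedSpace.exp (-t • (β • (1 - β • R β)))
  change ‖S (R 1 h) - T (R 1 h)‖ ≤ t * ‖_‖ at key
  have e : S f - T f = S (f - R 1 h) + (S (R 1 h) - T (R 1 h)) - T (f - R 1 h) := by
    rw [map_sub, map_sub]; abel
  rw [e]
  calc _ ≤ ‖S (f - R 1 h)‖ + ‖S (R 1 h) - T (R 1 h)‖ + ‖T (f - R 1 h)‖ :=
        (norm_sub_le _ _).trans (add_le_add_left (norm_add_le _ _) _)
    _ < ε := by
      have h1 : ‖S (f - R 1 h)‖ ≤ ‖f - R 1 h‖ := hY α hα0 t ht.le _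
      have h2 : ‖T (f - R 1 h)‖ ≤ ‖f - R 1 h‖ := hY β hβ0 t ht.le _
      linarith

end Exp

end ContractionSemigroup

noncomputable section

namespace WeightedGraph

/-! ### The Hilbert space `ℓ²(X, m)` -/

section Ell2

variable {X : Type*} [MeasurableSpace X] (G : WeightedGraph X)

variable {G} in
theorem ext_ell2 {f g : G.ell2} (h : ∀ x, f x = g x) : f = g :=
  Lp.ext (Eventually.of_forall h)

variable [DiscreteMeasurableSpace X]

variable {G} in
-- Points have positive mass, so there are no nonempty null sets and classes in `ℓ²` can be treated
-- as functions.
theorem eq_of_ae_eq {β : Type*} {f g : X → β} (h : f =ᵐ[G.measure] g) : f = g := by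
  funext x
  by_contra hx
  have h0 : G.measure {x} ≤ 0 := (measure_mono (by simpa using hx)).trans_eq (ae_iff.1 h)
  rw [G.measure_singleton, nonpos_iff_eq_zero, ENNReal.ofReal_eq_zero] at h0
  exact absurd (G.m_pos x) (not_lt.2 h0)

theorem coe_delta (x : X) : ⇑(G.delta x) = Set.indicator {x} fun _ => (1 : ℝ) :=
  eq_of_ae_eq indicatorConstLp_coeFn

theorem delta_self (x : X) : G.delta x x = 1 := by simp [coe_delta]

theorem delta_of_ne {x y : X} (h : y ≠ x) : G.delta x y = 0 := by simp [coe_delta, h]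

theorem measureReal_singleton (x : X) : G.measure.real {x} = G.m x := by
  rw [Measure.real, G.measure_singleton, ENNReal.toReal_ofReal (G.m_pos x).le]

theorem inner_delta (x : X) (f : G.ell2) : inner ℝ (G.delta x) f = G.m x * f x := by
  rw [delta, L2.inner_indicatorConstLp_one, integral_singleton, measureReal_singleton, smul_eq_mul]

/-- Evaluation at a vertex. -/
def evalL (x : X) : G.ell2 →L[ℝ] ℝ := (G.m x)⁻¹ • innerSL ℝ (G.delta x)

theorem evalL_apply (x : X) (f : G.ell2) : G.evalL x f = f x := by
  have := (G.m_pos x).ne'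
  simp only [evalL, smul_apply, innerSL_apply_apply, inner_delta, smul_eq_mul]
  field_simp

theorem coe_add (f g : G.ell2) (x : X) : (f + g : G.ell2) x = f x + g x := by
  simp only [← evalL_apply, map_add]

theorem coe_sub (f g : G.ell2) (x : X) : (f - g : G.ell2) x = f x - g x := by
  simp only [← evalL_apply, map_sub]

theorem coe_smul (c : ℝ) (f : G.ell2) (x : X) : (c • f : G.ell2) x = c * f x := by
  simp only [← evalL_apply, map_smul, smul_eq_mul]

theorem coe_zero (x : X) : (0 : G.ell2) x = 0 := by
  simp only [← evalL_apply, map_zero]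

theorem coe_sum {ι : Type*} (s : Finset ι) (f : ι → G.ell2) (x : X) :
    (∑ i ∈ s, f i : G.ell2) x = ∑ i ∈ s, f i x := by
  simp only [← evalL_apply, map_sum]

variable {G} in
theorem tendsto_coe {ι : Type*} {l : Filter ι} {f : ι → G.ell2} {g : G.ell2}
    (h : Tendsto f l (𝓝 g)) (x : X) : Tendsto (fun i => f i x) l (𝓝 (g x)) := by
  simp only [← evalL_apply]
  exact ((G.evalL x).continuous.tendsto g).comp h

theorem hasSum_inner (f g : G.ell2) :
    HasSum (fun x => G.m x * (f x * g x)) (inner ℝ f g) := by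
  rw [L2.inner_def]
  have h := hasSum_integral_measure (μ := fun x => ENNReal.ofReal (G.m x) • Measure.dirac x)
    (L2.integrable_inner (𝕜 := ℝ) f g)
  have e : ∀ x, ∫ y, inner ℝ (f y) (g y) ∂(ENNReal.ofReal (G.m x) • Measure.dirac x) =
      G.m x * (f x * g x) := fun x => by
    rw [integral_smul_measure, integral_dirac, ENNReal.toReal_ofReal (G.m_pos x).le, smul_eq_mul]
    simp [mul_comm]
  simp only [e] at h
  exact h

theorem eq_sum_delta {f : G.ell2} {s : Finset X} (hf : ∀ x ∉ s, f x = 0) :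
    f = ∑ x ∈ s, f x • G.delta x := by
  classical
  refine ext_ell2 fun y => ?_
  rw [coe_sum]
  simp only [coe_smul]
  by_cases hy : y ∈ s
  · rw [Finset.sum_eq_single y (fun z _ hz => by rw [G.delta_of_ne hz.symm, mul_zero])
      (fun h => absurd hy h), delta_self, mul_one]
  · rw [hf y hy, Finset.sum_eq_zero]
    intro z hz
    rw [G.delta_of_ne (by rintro rfl; exact hy hz), mul_zero]

end Ell2

/-! ### The discrete gradient -/

section Gradient

variable {X : Type*} (G : WeightedGraph X)

/-- The weighted degree of a vertex. -/
def deg (x : X) : ℝ := ∑' y, G.b x y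

theorem deg_nonneg (x : X) : 0 ≤ G.deg x := tsum_nonneg (G.b_nonneg x)

theorem sum_b_le_deg (x : X) (s : Finset X) : ∑ y ∈ s, G.b x y ≤ G.deg x :=
  (G.b_summable x).sum_le_tsum s fun y _ => G.b_nonneg x y

/-- The discrete gradient, normalised so that its square sums up to the energy. -/
def gradFun (f : X → ℝ) (q : X × X) : ℝ := √(G.b q.1 q.2 / 2) * (f q.1 - f q.2)

theorem gradFun_mul (f g : X → ℝ) (q : X × X) :
    G.gradFun f q * G.gradFun g q = 1 / 2 * (G.b q.1 q.2 * (f q.1 - f q.2) * (g q.1 - g q.2)) := by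
  have h := Real.mul_self_sqrt (show 0 ≤ G.b q.1 q.2 / 2 by have := G.b_nonneg q.1 q.2; positivity)
  unfold gradFun
  linear_combination (f q.1 - f q.2) * (g q.1 - g q.2) * h

theorem energy_eq (f : X → ℝ) : G.energy f = ∑' q, ENNReal.ofReal (G.gradFun f q ^ 2) := by
  rw [energy, ← ENNReal.tsum_prod (f := fun x y => ENNReal.ofReal (G.b x y * (f x - f y) ^ 2)),
    ← ENNReal.tsum_mul_left]
  refine tsum_congr fun q => ?_
  rw [sq (G.gradFun f q), gradFun_mul, ENNReal.ofReal_mul (p := 1 / 2) (by norm_num),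
    ENNReal.ofReal_div_of_pos (by norm_num)]
  simp only [ENNReal.ofReal_one, ENNReal.ofReal_ofNat]
  congr 2
  ring

theorem energyForm_eq (f g : X → ℝ) :
    G.energyForm f g = ∑' q, G.gradFun f q * G.gradFun g q := by
  simp only [energyForm, gradFun_mul, tsum_mul_left]

theorem memℓp_gradFun_iff {f : X → ℝ} : Memℓp (G.gradFun f) 2 ↔ G.energy f ≠ ∞ := by
  rw [memℓp_gen_iff (by norm_num), energy_eq]
  simp only [ENNReal.toReal_ofNat, Real.rpow_ofNat, Real.norm_eq_abs, sq_abs]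
  refine ⟨fun h => h.tsum_ofReal_ne_top, fun h => ?_⟩
  have := ENNReal.summable_toReal h
  simpa only [ENNReal.toReal_ofReal (sq_nonneg _)] using this

theorem energy_eq_enorm (w : lp (fun _ : X × X => ℝ) 2) {f : X → ℝ} (h : ∀ q, w q = G.gradFun f q) :
    G.energy f = ‖w‖ₑ ^ 2 := by
  have hs := lp.hasSum_norm (p := 2) (by norm_num) w
  simp only [ENNReal.toReal_ofNat, Real.rpow_ofNat, Real.norm_eq_abs, sq_abs, h] at hs
  rw [energy_eq, ← ENNReal.ofReal_tsum_of_nonneg (fun q => sq_nonneg _) hs.summable, hs.tsum_eq,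
    ENNReal.ofReal_pow (norm_nonneg _), ofReal_norm]

/-- Green's formula against `1_x`. Only edges with an endpoint at `x` contribute; those starting and
those ending there give equal halves by symmetry of `b`. -/
theorem hasSum_gradFun_mul_indicator (s : Finset X) {u : X → ℝ} (hu : ∀ y ∉ s, u y = 0) (x : X) :
    HasSum (fun q => G.gradFun u q * G.gradFun (Set.indicator {x} fun _ => 1) q)
      (G.deg x * u x - ∑ y ∈ s, G.b x y * u y) := by
  classical
  have h0 : HasSum (fun y => 1 / 2 * (G.b x y * (u x - u y)))
      (1 / 2 * (G.deg x * u x - ∑ y ∈ s, G.b x y * u y)) := by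
    refine HasSum.mul_left _ ?_
    simp only [mul_sub]
    exact ((G.b_summable x).hasSum.mul_right (u x)).sub
      (hasSum_sum_of_ne_finset_zero fun y hy => by rw [hu y hy, mul_zero])
  have h1 : HasSum (fun q : X × X => if q.1 = x then 1 / 2 * (G.b q.1 q.2 * (u q.1 - u q.2)) else 0)
      (1 / 2 * (G.deg x * u x - ∑ y ∈ s, G.b x y * u y)) := by
    refine (Function.Injective.hasSum_iff (Prod.mk_right_injective x) ?_).1 ?_
    · intro q hq
      rw [if_neg]
      rintro rfl
      exact hq ⟨q.2, rfl⟩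
    · simpa [Function.comp_def] using h0
  have h2 : HasSum (fun q : X × X => if q.2 = x then 1 / 2 * (G.b q.1 q.2 * (u q.2 - u q.1)) else 0)
      (1 / 2 * (G.deg x * u x - ∑ y ∈ s, G.b x y * u y)) := by
    refine ((Equiv.prodComm X X).hasSum_iff.1 ?_)
    convert h1 using 2 with q
    simp [G.b_symm q.2 q.1]
  convert h1.add h2 using 1
  · funext q
    rw [gradFun_mul]
    by_cases hx : q.1 = x <;> by_cases hy : q.2 = x <;>
      simp [Set.indicator, hx, hy]
    ring
  · ring

end Gradient

end WeightedGraph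

end

noncomputable section

namespace WeightedGraph

/-! ### The resolvent as a compressed orthogonal projection -/

section Resolvent

section GradFun

variable {X : Type*} (G : WeightedGraph X)

theorem gradFun_add (f g : X → ℝ) (q : X × X) :
    G.gradFun (f + g) q = G.gradFun f q + G.gradFun g q := by
  simp only [gradFun, Pi.add_apply]; ring

theorem gradFun_sub (f g : X → ℝ) (q : X × X) :
    G.gradFun (f - g) q = G.gradFun f q - G.gradFun g q := by
  simp only [gradFun, Pi.sub_apply]; ring

theorem gradFun_smul (c : ℝ) (f : X → ℝ) (q : X × X) :
    G.gradFun (c • f) q = c * G.gradFun f q := by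
  simp only [gradFun, Pi.smul_apply, smul_eq_mul]; ring

theorem gradFun_zero (q : X × X) : G.gradFun 0 q = 0 := by
  simp [gradFun]

end GradFun

/-- Pairs of a square summable function on vertices and a square summable function on edges. -/
abbrev PairSpace {X : Type*} [MeasurableSpace X] (G : WeightedGraph X) : Type _ :=
  WithLp 2 (G.ell2 × lp (fun _ : X × X => ℝ) 2)

variable {X : Type*} [MeasurableSpace X] (G : WeightedGraph X)

/-- The embedding of `ℓ²(X, m)` as the first factor. -/
def vertexInl : G.ell2 →L[ℝ] G.PairSpace :=
  (WithLp.prodContinuousLinearEquiv 2 ℝ _ _).symm.toContinuousLinearMap ∘L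
    ContinuousLinearMap.inl ℝ _ _

theorem inner_vertexInl_left (f : G.ell2) (p : G.PairSpace) :
    inner ℝ (G.vertexInl f) p = inner ℝ f p.fst := by
  rw [WithLp.prod_inner_apply]
  change inner ℝ f p.fst + inner ℝ 0 p.snd = _
  rw [inner_zero_left, add_zero]

theorem norm_vertexInl (f : G.ell2) : ‖G.vertexInl f‖ = ‖f‖ := by
  rw [← sq_eq_sq₀ (norm_nonneg _) (norm_nonneg _), ← real_inner_self_eq_norm_sq,
    inner_vertexInl_left, ← real_inner_self_eq_norm_sq]
  rfl

variable {G} in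
theorem continuous_snd_apply (q : X × X) : Continuous fun p : G.PairSpace => p.snd q :=
  (lp.evalCLM ℝ (fun _ : X × X => ℝ) (p := 2) q).continuous.comp (WithLp.sndL 2 ℝ _ _).continuous

variable [DiscreteMeasurableSpace X]

theorem coe_add' (f g : G.ell2) : ⇑(f + g) = ⇑f + ⇑g := funext (G.coe_add f g)

theorem coe_sub' (f g : G.ell2) : ⇑(f - g) = ⇑f - ⇑g := funext (G.coe_sub f g)

theorem coe_smul' (c : ℝ) (f : G.ell2) : ⇑(c • f) = c • ⇑f := funext (G.coe_smul c f)

theorem coe_zero' : ⇑(0 : G.ell2) = 0 := funext G.coe_zero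

theorem memℓp_gradFun_delta (x : X) : Memℓp (G.gradFun (G.delta x)) 2 := by
  rw [memℓp_gen_iff (by norm_num), coe_delta]
  have h := (G.hasSum_gradFun_mul_indicator {x} (u := Set.indicator {x} fun _ => 1)
    (fun y hy => by simpa using hy) x).summable
  simpa only [ENNReal.toReal_ofNat, Real.rpow_ofNat, Real.norm_eq_abs, sq_abs, ← sq] using h

/-- The gradient of the indicator function of a vertex. -/
def gradDelta (x : X) : lp (fun _ : X × X => ℝ) 2 :=
  ⟨G.gradFun (G.delta x), G.memℓp_gradFun_delta x⟩

/-- The point `(√α 1_x, ∇ 1_x)` of the (rescaled) graph of the gradient. -/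
def graphVec (α : ℝ) (x : X) : G.PairSpace :=
  WithLp.toLp 2 (√α • G.delta x, G.gradDelta x)

/-- The closure of the graph `{(√α φ, ∇ φ)}`, with `φ` finitely supported in `S`. -/
abbrev graphSpace (α : ℝ) (S : Set X) : Submodule ℝ G.PairSpace :=
  (Submodule.span ℝ (G.graphVec α '' S)).topologicalClosure

variable {G}

/-- With `exists_mem_span`, this identifies the span, before closure, with the scaled graph of the
gradient over finitely supported functions. -/
theorem exists_of_mem_span {α : ℝ} {S : Set X} {p : G.PairSpace}
    (hp : p ∈ Submodule.span ℝ (G.graphVec α '' S)) :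
    ∃ (s : Finset X) (φ : G.ell2), ↑s ⊆ S ∧ (∀ x ∉ s, φ x = 0) ∧ p.fst = √α • φ ∧
      ∀ q, p.snd q = G.gradFun φ q := by
  classical
  induction hp using Submodule.span_induction with
  | mem p hp =>
    obtain ⟨x, hx, rfl⟩ := hp
    exact ⟨{x}, G.delta x, by simpa using hx, fun y hy => G.delta_of_ne (by simpa using hy), rfl,
      fun q => rfl⟩
  | zero =>
    exact ⟨∅, 0, by simp, fun x _ => G.coe_zero x, by simp, fun q => by
      rw [coe_zero', gradFun_zero]; rfl⟩
  | add p p' _ _ h h' =>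
    obtain ⟨s, φ, hs, h0, h1, h2⟩ := h
    obtain ⟨s', φ', hs', h0', h1', h2'⟩ := h'
    refine ⟨s ∪ s', φ + φ', by simp [hs, hs'], fun x hx => ?_, ?_, fun q => ?_⟩
    · simp only [Finset.mem_union, not_or] at hx
      rw [coe_add, h0 x hx.1, h0' x hx.2, add_zero]
    · rw [WithLp.add_fst, h1, h1', smul_add]
    · rw [coe_add', gradFun_add, ← h2, ← h2']; rfl
  | smul c p _ h =>
    obtain ⟨s, φ, hs, h0, h1, h2⟩ := h
    refine ⟨s, c • φ, hs, fun x hx => ?_, ?_, fun q => ?_⟩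
    · rw [coe_smul, h0 x hx, mul_zero]
    · rw [WithLp.smul_fst, h1, smul_comm]
    · rw [coe_smul', gradFun_smul, ← h2]; rfl

theorem exists_mem_span {α : ℝ} {S : Set X} (s : Finset X) (hs : ↑s ⊆ S) (φ : G.ell2)
    (h0 : ∀ x ∉ s, φ x = 0) :
    ∃ p ∈ Submodule.span ℝ (G.graphVec α '' S), p.fst = √α • φ ∧ ∀ q, p.snd q = G.gradFun φ q := by
  classical
  refine ⟨∑ x ∈ s, φ x • G.graphVec α x, Submodule.sum_mem _ fun x hx =>
    Submodule.smul_mem _ _ (Submodule.subset_span ⟨x, hs hx, rfl⟩), ?_⟩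
  suffices h : ∀ s : Finset X, (∑ x ∈ s, φ x • G.graphVec α x).fst = √α • ∑ x ∈ s, φ x • G.delta x ∧
      ∀ q, (∑ x ∈ s, φ x • G.graphVec α x).snd q =
        G.gradFun (∑ x ∈ s, φ x • G.delta x : G.ell2) q by
    have h' := h s
    rwa [← G.eq_sum_delta h0] at h'
  intro s
  induction s using Finset.induction_on with
  | empty => exact ⟨by simp, fun q => by
      rw [Finset.sum_empty, Finset.sum_empty, coe_zero', gradFun_zero]; rfl⟩
  | insert x s hx ih =>
    rw [Finset.sum_insert hx, Finset.sum_insert hx]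
    refine ⟨?_, fun q => ?_⟩
    · rw [WithLp.add_fst, ih.1, smul_add, WithLp.smul_fst, smul_comm (√α)]
      rfl
    · rw [coe_add', gradFun_add, ← ih.2, coe_smul', gradFun_smul]
      rfl

theorem continuous_fst_apply (x : X) : Continuous fun p : G.PairSpace => p.fst x := by
  simp only [← evalL_apply]
  exact (G.evalL x).continuous.comp (WithLp.fstL 2 ℝ _ _).continuous

/-- Closability of the form: the relation between a function and its gradient is a closed condition
edge by edge, so it survives the closure. -/
theorem snd_apply_of_mem_graphSpace {α : ℝ} {S : Set X} {p : G.PairSpace}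
    (hp : p ∈ G.graphSpace α S) (q : X × X) : √α * p.snd q = G.gradFun p.fst q := by
  have hc : IsClosed {p : G.PairSpace | √α * p.snd q = G.gradFun p.fst q} := by
    refine isClosed_eq (continuous_const.mul (continuous_snd_apply q)) ?_
    exact continuous_const.mul ((continuous_fst_apply q.1).sub (continuous_fst_apply q.2))
  refine closure_minimal (fun p hp => ?_) hc hp
  obtain ⟨s, φ, -, -, h1, h2⟩ := exists_of_mem_span hp
  rw [Set.mem_ofPred_eq, h1, h2, coe_smul', gradFun_smul]

theorem snd_apply_eq_gradFun {α : ℝ} (hα : 0 < α) {S : Set X} {p : G.PairSpace}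
    (hp : p ∈ G.graphSpace α S) {f : G.ell2} (hf : p.fst = √α • f) (q : X × X) :
    p.snd q = G.gradFun f q := by
  have h := snd_apply_of_mem_graphSpace hp q
  rw [hf, coe_smul', gradFun_smul] at h
  exact mul_left_cancel₀ (Real.sqrt_pos.2 hα).ne' h

theorem fst_apply_of_mem_graphSpace {α : ℝ} {S : Set X} {p : G.PairSpace}
    (hp : p ∈ G.graphSpace α S) {x : X} (hx : x ∉ S) : p.fst x = 0 := by
  have hc : IsClosed {p : G.PairSpace | p.fst x = 0} :=
    isClosed_eq (continuous_fst_apply x) continuous_const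
  refine closure_minimal (fun p hp => ?_) hc hp
  obtain ⟨s, φ, hs, h0, h1, -⟩ := exists_of_mem_span hp
  rw [Set.mem_ofPred_eq, h1, coe_smul, h0 x fun h => hx (hs h), mul_zero]

theorem exists_mem_graphSpace_of_mem_dirichletDomain {α : ℝ} (hα : 0 < α) {f : G.ell2}
    (hf : f ∈ G.dirichletDomain) : ∃ p ∈ G.graphSpace α Set.univ, p.fst = √α • f := by
  -- Finite energy of `f` follows from a single approximant, with `ε = 1`: both `f - φ` and the
  -- finitely supported `φ` have finite energy.
  have hen : Memℓp (G.gradFun f) 2 := by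
    obtain ⟨φ, hφ, he⟩ := hf 1 one_pos
    have h1 : Memℓp (G.gradFun (f - φ : G.ell2)) 2 := G.memℓp_gradFun_iff.2
      (ne_top_of_le_ne_top ENNReal.one_ne_top (le_self_add.trans he.le))
    obtain ⟨p, -, -, hp⟩ := exists_mem_span (α := α) (S := Set.univ) hφ.toFinset
      (Set.subset_univ _) φ (fun x hx => by simpa using hx)
    have h2 : Memℓp (fun q => p.snd q) 2 := lp.memℓp p.snd
    convert h1.add h2 using 1
    funext q
    rw [Pi.add_apply, hp, coe_sub', gradFun_sub, sub_add_cancel]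
  set w : lp (fun _ : X × X => ℝ) 2 := ⟨G.gradFun f, hen⟩ with hw
  refine ⟨WithLp.toLp 2 (√α • f, w), ?_, rfl⟩
  refine Metric.mem_closure_iff.2 fun ε hε => ?_
  -- The squared norm of the pair weights `‖f - φ‖ ^ 2` by `α`, so it is at most `α + 1` times the
  -- squared form norm.
  set δ : ℝ := ε ^ 2 / (α + 1) with hδ
  have hδ0 : 0 < δ := by positivity
  obtain ⟨φ, hφ, he⟩ := hf (ENNReal.ofReal δ) (ENNReal.ofReal_pos.2 hδ0)
  obtain ⟨p, hp, hp1, hp2⟩ := exists_mem_span (α := α) (S := Set.univ) hφ.toFinset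
    (Set.subset_univ _) φ (fun x hx => by simpa using hx)
  refine ⟨p, hp, ?_⟩
  rw [G.energy_eq_enorm (w - p.snd) (fun q => by
    rw [coe_sub', gradFun_sub, ← hp2]; rfl), ← ofReal_norm, ← ofReal_norm,
    ← ENNReal.ofReal_pow (norm_nonneg _), ← ENNReal.ofReal_pow (norm_nonneg _),
    ← ENNReal.ofReal_add (by positivity) (by positivity), ENNReal.ofReal_lt_ofReal_iff hδ0] at he
  rw [dist_eq_norm]
  refine lt_of_pow_lt_pow_left₀ 2 hε.le ?_
  rw [WithLp.prod_norm_sq_eq_of_L2]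
  have e1 : (WithLp.toLp 2 (√α • f, w) - p).fst = √α • (f - φ) := by
    rw [WithLp.sub_fst, hp1, smul_sub]
    rfl
  have e2 : (WithLp.toLp 2 (√α • f, w) - p).snd = w - p.snd := rfl
  rw [e1, e2, norm_smul, mul_pow, Real.norm_of_nonneg (Real.sqrt_nonneg α), Real.sq_sqrt hα.le]
  rw [hδ, lt_div_iff₀ (by positivity)] at he
  nlinarith [sq_nonneg ‖f - φ‖, sq_nonneg ‖w - p.snd‖]

theorem mem_dirichletDomain_of_mem_graphSpace {α : ℝ} (hα : 0 < α) {f : G.ell2} {p : G.PairSpace}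
    (hp : p ∈ G.graphSpace α Set.univ) (hf : p.fst = √α • f) : f ∈ G.dirichletDomain := by
  intro ε hε
  -- The tolerance `ε` may be infinite, so it is first replaced by a positive real.
  obtain ⟨r, hr0, hr⟩ : ∃ r : ℝ, 0 < r ∧ ENNReal.ofReal r ≤ ε := by
    refine ⟨(min ε 1).toReal, ENNReal.toReal_pos (lt_min hε one_pos).ne'
      (ne_top_of_le_ne_top ENNReal.one_ne_top (min_le_right _ _)), ?_⟩
    rw [ENNReal.ofReal_toReal (ne_top_of_le_ne_top ENNReal.one_ne_top (min_le_right _ _))]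
    exact min_le_left _ _
  set δ : ℝ := √(r * α / (α + 1)) with hδ
  have hδ0 : 0 < δ := Real.sqrt_pos.2 (by positivity)
  obtain ⟨p', hp', hd⟩ := Metric.mem_closure_iff.1 hp δ hδ0
  obtain ⟨s, φ, -, h0, h1, h2⟩ := exists_of_mem_span hp'
  refine ⟨φ, s.finite_toSet.subset fun x hx => by_contra fun h => hx (h0 x h), ?_⟩
  refine lt_of_lt_of_le ?_ hr
  rw [G.energy_eq_enorm (p.snd - p'.snd) (fun q => by
    rw [coe_sub', gradFun_sub, ← h2, ← snd_apply_eq_gradFun hα hp hf]; rfl), ← ofReal_norm,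
    ← ofReal_norm, ← ENNReal.ofReal_pow (norm_nonneg _), ← ENNReal.ofReal_pow (norm_nonneg _),
    ← ENNReal.ofReal_add (by positivity) (by positivity), ENNReal.ofReal_lt_ofReal_iff hr0]
  rw [dist_eq_norm] at hd
  have hd2 : ‖p - p'‖ ^ 2 < r * α / (α + 1) := by
    have := pow_lt_pow_left₀ hd (norm_nonneg _) two_ne_zero
    rwa [hδ, Real.sq_sqrt (by positivity)] at this
  rw [WithLp.prod_norm_sq_eq_of_L2, WithLp.sub_fst, WithLp.sub_snd, hf, h1, ← smul_sub, norm_smul,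
    mul_pow, Real.norm_of_nonneg (Real.sqrt_nonneg α), Real.sq_sqrt hα.le,
    lt_div_iff₀ (by positivity)] at hd2
  have h3 : 0 ≤ ‖f - φ‖ ^ 2 := by positivity
  have h4 : 0 ≤ ‖p.snd - p'.snd‖ ^ 2 := by positivity
  have h5 : α * (‖p.snd - p'.snd‖ ^ 2 + ‖f - φ‖ ^ 2) < α * r := by
    nlinarith [mul_nonneg hα.le h3, mul_nonneg (mul_nonneg hα.le hα.le) h3]
  exact lt_of_mul_lt_mul_left h5 hα.le

theorem inner_of_mem_graphSpace {α : ℝ} (hα : 0 < α) {S : Set X} {f g : G.ell2} {p p' : G.PairSpace}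
    (hp : p ∈ G.graphSpace α S) (hp' : p' ∈ G.graphSpace α S) (hf : p.fst = √α • f)
    (hg : p'.fst = √α • g) : inner ℝ p p' = α * inner ℝ f g + G.energyForm f g := by
  rw [WithLp.prod_inner_apply]
  change inner ℝ p.fst p'.fst + inner ℝ p.snd p'.snd = _
  rw [hf, hg, real_inner_smul_left, real_inner_smul_right, ← mul_assoc, Real.mul_self_sqrt hα.le,
    lp.inner_eq_tsum, energyForm_eq]
  congr 1
  refine tsum_congr fun q => ?_
  rw [snd_apply_eq_gradFun hα hp hf, snd_apply_eq_gradFun hα hp' hg]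
  exact mul_comm _ _

/-! ### Resolvents of the restricted forms: weak equation, resolvent identity and monotone limits -/

variable (G)

/-- The resolvent at `α` of the energy form restricted to the closure of the functions with finite
support in `S`. -/
def formResolvent (α : ℝ) (S : Set X) : G.ell2 →L[ℝ] G.ell2 :=
  α⁻¹ • (WithLp.fstL 2 ℝ _ _ ∘L (G.graphSpace α S).starProjection ∘L G.vertexInl)

theorem formResolvent_apply (α : ℝ) (S : Set X) (f : G.ell2) :
    G.formResolvent α S f = α⁻¹ • ((G.graphSpace α S).starProjection (G.vertexInl f)).fst := rfl

theorem norm_smul_formResolvent_apply_le {α : ℝ} (hα : 0 < α) (S : Set X) (f : G.ell2) :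
    ‖(α • G.formResolvent α S) f‖ ≤ ‖f‖ := by
  rw [smul_apply, formResolvent_apply, smul_inv_smul₀ hα.ne', ← G.norm_vertexInl f]
  refine (WithLp.norm_fst_le _ _).trans ?_
  exact (ContinuousLinearMap.le_of_opNorm_le _ (Submodule.starProjection_norm_le _) _).trans_eq
    (one_mul _)

theorem inner_formResolvent (α : ℝ) (S : Set X) (f g : G.ell2) :
    inner ℝ (G.formResolvent α S f) g = inner ℝ f (G.formResolvent α S g) := by
  rw [formResolvent_apply, formResolvent_apply, real_inner_smul_left, real_inner_smul_right,
    ← inner_vertexInl_left, ← Submodule.inner_starProjection_left_eq_right, real_inner_comm,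
    ← inner_vertexInl_left, real_inner_comm]

/-- The weak form of `(L + α) u = f`: orthogonality of `(f, 0)` minus its projection to the graph is
exactly this equation, since the inner product of the pair space is `α ⟨u, g⟩ + 𝒬(u, g)` there. -/
theorem exists_formResolvent {α : ℝ} (hα : 0 < α) (S : Set X) (f : G.ell2) :
    ∃ p ∈ G.graphSpace α S, p.fst = √α • G.formResolvent α S f ∧
      ∀ p' ∈ G.graphSpace α S, ∀ g, p'.fst = √α • g → inner ℝ p p' = inner ℝ f g := by
  have h0 : √α ≠ 0 := (Real.sqrt_pos.2 hα).ne'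
  refine ⟨(√α)⁻¹ • (G.graphSpace α S).starProjection (G.vertexInl f),
    Submodule.smul_mem _ _ (Submodule.starProjection_apply_mem _ _), ?_, fun p' hp' g hg => ?_⟩
  · rw [formResolvent_apply, smul_smul, WithLp.smul_fst]
    congr 1
    nth_rewrite 3 [← Real.mul_self_sqrt hα.le]
    field_simp
  · have h := Submodule.starProjection_inner_eq_zero (K := G.graphSpace α S) (G.vertexInl f) p' hp'
    rw [inner_sub_left, sub_eq_zero] at h
    rw [real_inner_smul_left, ← h, inner_vertexInl_left, hg, real_inner_smul_right,
      inv_mul_cancel_left₀ h0]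

/-- Uniqueness of weak solutions: the difference of two of them lies in the graph space and is
orthogonal to it. This ties the abstract resolvent to the projection. -/
theorem isDirichletLaplacian_iff {α : ℝ} (hα : 0 < α) (u f : G.ell2) :
    G.IsDirichletLaplacian u (f - α • u) ↔ u = G.formResolvent α Set.univ f := by
  obtain ⟨p, hp, hp1, hp2⟩ := G.exists_formResolvent hα Set.univ f
  constructor
  · rintro ⟨hu, h⟩
    obtain ⟨r, hr, hr1⟩ := exists_mem_graphSpace_of_mem_dirichletDomain hα hu
    have h0 : √α ≠ 0 := (Real.sqrt_pos.2 hα).ne'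
    have key : ∀ p' ∈ G.graphSpace α Set.univ, inner ℝ (r - p) p' = 0 := fun p' hp' => by
      obtain ⟨g, hg⟩ : ∃ g, p'.fst = √α • g := ⟨(√α)⁻¹ • p'.fst, by rw [smul_inv_smul₀ h0]⟩
      rw [inner_sub_left, hp2 p' hp' g hg, inner_of_mem_graphSpace hα hr hp' hr1 hg,
        h g (mem_dirichletDomain_of_mem_graphSpace hα hp' hg), inner_sub_left, real_inner_smul_left]
      ring
    have hz := inner_self_eq_zero.1 (key _ (Submodule.sub_mem _ hr hp))
    rw [sub_eq_zero] at hz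
    rw [hz, hp1] at hr1
    exact (smul_right_injective _ h0 hr1).symm
  · rintro rfl
    refine ⟨mem_dirichletDomain_of_mem_graphSpace hα hp hp1, fun v hv => ?_⟩
    obtain ⟨r, hr, hr1⟩ := exists_mem_graphSpace_of_mem_dirichletDomain hα hv
    have h := hp2 r hr v hr1
    rw [inner_of_mem_graphSpace hα hp hr hp1 hr1] at h
    rw [inner_sub_left, real_inner_smul_left]
    linarith

theorem dirichletResolvent_eq {α : ℝ} (hα : 0 < α) :
    G.dirichletResolvent α = G.formResolvent α Set.univ := by
  have h : ∃ R : G.ell2 →L[ℝ] G.ell2, ∀ f, G.IsDirichletLaplacian (R f) (f - α • R f) :=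
    ⟨_, fun f => (G.isDirichletLaplacian_iff hα _ f).2 rfl⟩
  rw [dirichletResolvent, dif_pos h]
  ext1 f
  exact (G.isDirichletLaplacian_iff hα _ f).1 (h.choose_spec f)

theorem formResolvent_eq_add {α β : ℝ} (hα : 0 < α) (hβ : 0 < β) (f : G.ell2) :
    G.formResolvent α Set.univ f = G.formResolvent β Set.univ f +
      (β - α) • G.formResolvent β Set.univ (G.formResolvent α Set.univ f) := by
  rw [← map_smul, ← map_add, ← G.isDirichletLaplacian_iff hβ]
  convert (G.isDirichletLaplacian_iff hα _ f).2 rfl using 1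
  module

theorem graphVec_mem_graphSpace (α : ℝ) {S : Set X} {x : X} (hx : x ∈ S) :
    G.graphVec α x ∈ G.graphSpace α S :=
  Submodule.le_topologicalClosure _ (Submodule.subset_span ⟨x, hx, rfl⟩)

/-- By symmetry of the resolvent, a vector orthogonal to the range lies in its kernel. Testing the
weak equation of the zero solution against every `1_x` then shows that the vector vanishes. -/
theorem denseRange_formResolvent {α : ℝ} (hα : 0 < α) :
    DenseRange (G.formResolvent α Set.univ) := by
  have h : (LinearMap.range (G.formResolvent α Set.univ).toLinearMap)ᗮ = ⊥ := by
    refine (Submodule.eq_bot_iff _).2 fun h hh => ?_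
    have h0 : G.formResolvent α Set.univ h = 0 := by
      refine ext_inner_left ℝ fun v => ?_
      rw [← inner_formResolvent, inner_zero_right]
      exact (Submodule.mem_orthogonal _ _).1 hh _ ⟨v, rfl⟩
    obtain ⟨p, hp, hp1, hp2⟩ := G.exists_formResolvent hα Set.univ h
    rw [h0] at hp1
    refine ext_ell2 fun x => ?_
    have hx := G.graphVec_mem_graphSpace α (Set.mem_univ x)
    have e1 := hp2 _ hx (G.delta x) rfl
    rw [inner_of_mem_graphSpace hα hp hx hp1 rfl, real_inner_comm, inner_zero_right,
      real_inner_comm, inner_delta, energyForm_eq, coe_zero'] at e1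
    simp only [gradFun_zero, zero_mul, tsum_zero, mul_zero, add_zero] at e1
    rw [coe_zero]
    exact (mul_eq_zero.1 e1.symm).resolve_left (G.m_pos x).ne'
  have h' := Submodule.topologicalClosure_eq_top_iff.2 h
  exact (Submodule.dense_iff_topologicalClosure_eq_top).2 h'

/-- Projections onto increasing subspaces converge strongly to the projection onto the closure of
their union, here the graph space of all of `X`. -/
theorem tendsto_formResolvent {K : ℕ → Finset X} (hmono : Monotone K) (hK : ∀ x, ∃ k, x ∈ K k)
    (α : ℝ) (f : G.ell2) :
    Tendsto (fun k => G.formResolvent α (K k) f) atTop (𝓝 (G.formResolvent α Set.univ f)) := by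
  have hU : Monotone fun k => G.graphSpace α (K k) := fun i j hij =>
    Submodule.topologicalClosure_mono (Submodule.span_mono (Set.image_mono (by
      exact_mod_cast hmono hij)))
  have hsup : (⨆ k, G.graphSpace α (K k)).topologicalClosure = G.graphSpace α Set.univ := by
    refine le_antisymm ?_ ?_
    · refine Submodule.topologicalClosure_minimal _ (iSup_le fun k => ?_)
        (Submodule.isClosed_topologicalClosure _)
      exact Submodule.topologicalClosure_mono (Submodule.span_mono
        (Set.image_mono (Set.subset_univ _)))
    · refine Submodule.topologicalClosure_mono (Submodule.span_le.2 ?_)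
      rintro _ ⟨x, -, rfl⟩
      obtain ⟨k, hk⟩ := hK x
      exact Submodule.mem_iSup_of_mem k (G.graphVec_mem_graphSpace α (by exact_mod_cast hk))
  have h := Submodule.starProjection_tendsto_closure_iSup _ hU (G.vertexInl f)
  simp only [formResolvent_apply]
  refine Tendsto.const_smul ?_ _
  have h2 := ((WithLp.fstL 2 ℝ G.ell2 (lp (fun _ : X × X => ℝ) 2)).continuous.tendsto _).comp h
  simp only [hsup] at h2
  exact h2

theorem formResolvent_apply_of_notMem (α : ℝ) {S : Set X} (f : G.ell2) {x : X}
    (hx : x ∉ S) : G.formResolvent α S f x = 0 := by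
  rw [formResolvent_apply, coe_smul, fst_apply_of_mem_graphSpace
    (Submodule.starProjection_apply_mem _ _) hx, mul_zero]

/-- The equation solved by the resolvent of a finite set. -/
theorem formResolvent_equation {α : ℝ} (hα : 0 < α) (s : Finset X) (f : G.ell2) {x : X}
    (hx : x ∈ s) :
    (α * G.m x + G.deg x) * G.formResolvent α s f x -
      ∑ y ∈ s, G.b x y * G.formResolvent α s f y = G.m x * f x := by
  obtain ⟨p, hp, hp1, hp2⟩ := G.exists_formResolvent hα s f
  have hxs := G.graphVec_mem_graphSpace α (S := (s : Set X)) (by exact_mod_cast hx)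
  have h := hp2 _ hxs (G.delta x) rfl
  rw [inner_of_mem_graphSpace hα hp hxs hp1 rfl, real_inner_comm, inner_delta, real_inner_comm,
    inner_delta, energyForm_eq, coe_delta, (G.hasSum_gradFun_mul_indicator s (fun y hy =>
      G.formResolvent_apply_of_notMem α f (by exact_mod_cast hy)) x).tsum_eq] at h
  linarith

end Resolvent

end WeightedGraph

end

noncomputable section

namespace WeightedGraph

/-! ### Finite graphs -/

section Finite

open ContractionSemigroup

section Positive

variable {V : Type*} [Fintype V]

theorem exp_nonneg {T : (V → ℝ) →L[ℝ] (V → ℝ)} (hT : ∀ f, 0 ≤ f → 0 ≤ T f) {f : V → ℝ}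
    (hf : 0 ≤ f) : 0 ≤ NormedSpace.exp T f := by
  refine (hasSum_exp_apply T f).nonneg fun n => smul_nonneg (by positivity) ?_
  induction n with
  | zero => simpa using hf
  | succ n ih => rw [pow_succ']; exact hT _ ih

/-- Only the zeroth term of the exponential series survives `φ`. With `φ` the total mass this is
conservation of mass. -/
theorem map_exp_of_comp_eq_zero {F : Type*} [NormedAddCommGroup F] [NormedSpace ℝ F]
    {T : (V → ℝ) →L[ℝ] (V → ℝ)} (φ : (V → ℝ) →L[ℝ] F) (h : ∀ f, φ (T f) = 0) (f : V → ℝ) :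
    φ (NormedSpace.exp T f) = φ f := by
  have hs := (hasSum_exp_apply T f).mapL φ
  refine hs.unique ?_
  convert hasSum_single 0 fun n hn => ?_ using 1
  · simp
  · obtain ⟨k, rfl⟩ := Nat.exists_eq_succ_of_ne_zero hn
    rw [map_smul, Nat.succ_eq_add_one, pow_succ']
    change _ • φ (T _) = 0
    rw [h, smul_zero]

end Positive

/-! ### Positivity, conservation of mass and the minimum principle on a finite graph -/

variable {V : Type*} [Fintype V] (G : WeightedGraph V)

/-- The Laplacian of a finite graph as a bounded operator. -/
abbrev lapL : (V → ℝ) →L[ℝ] (V → ℝ) := LinearMap.toContinuousLinearMap G.finiteLaplacian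

theorem lapL_apply (f : V → ℝ) (x : V) :
    G.lapL f x = 1 / G.m x * ∑ y, G.b x y * (f x - f y) := rfl

theorem m_mul_lapL_apply (f : V → ℝ) (x : V) :
    G.m x * G.lapL f x = ∑ y, G.b x y * (f x - f y) := by
  rw [lapL_apply, ← mul_assoc, mul_one_div_cancel (G.m_pos x).ne', one_mul]

/-- The total mass of a function. -/
def mass : (V → ℝ) →L[ℝ] ℝ :=
  ∑ x, G.m x • ContinuousLinearMap.proj (R := ℝ) (φ := fun _ : V => ℝ) x

theorem mass_apply (f : V → ℝ) : G.mass f = ∑ x, G.m x * f x := by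
  simp [mass]

/-- The norm of `ℓ¹(V, m)`. -/
def l1Seminorm : Seminorm ℝ (V → ℝ) :=
  Seminorm.of (fun f => ∑ x, G.m x * |f x|)
    (fun f g => by
      rw [← Finset.sum_add_distrib]
      refine Finset.sum_le_sum fun x _ => ?_
      rw [← mul_add]
      exact mul_le_mul_of_nonneg_left (abs_add_le _ _) (G.m_pos x).le)
    (fun c f => by
      rw [Finset.mul_sum]
      refine Finset.sum_congr rfl fun x _ => ?_
      rw [Pi.smul_apply, smul_eq_mul, abs_mul, Real.norm_eq_abs]
      ring)

theorem l1Seminorm_apply (f : V → ℝ) : G.l1Seminorm f = ∑ x, G.m x * |f x| := rfl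

theorem continuous_l1Seminorm : Continuous G.l1Seminorm := by
  change Continuous fun f : V → ℝ => ∑ x, G.m x * |f x|
  fun_prop

theorem l1Seminorm_single [DecidableEq V] (x : V) : G.l1Seminorm (Pi.single x 1) = G.m x := by
  rw [l1Seminorm_apply, Finset.sum_eq_single x]
  · simp
  · intro y _ hy
    simp [hy]
  · simp

theorem mass_lapL (f : V → ℝ) : G.mass (G.lapL f) = 0 := by
  have h : G.mass (G.lapL f) = ∑ x, ∑ y, G.b x y * (f x - f y) := by
    rw [mass_apply]
    exact Finset.sum_congr rfl fun x _ => G.m_mul_lapL_apply f x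
  have h' := h
  rw [Finset.sum_comm] at h'
  have : G.mass (G.lapL f) = -G.mass (G.lapL f) := by
    nth_rewrite 1 [h']
    rw [h, ← Finset.sum_neg_distrib]
    refine Finset.sum_congr rfl fun x _ => ?_
    rw [← Finset.sum_neg_distrib]
    refine Finset.sum_congr rfl fun y _ => ?_
    rw [G.b_symm y x]
    ring
  linarith

/-- Positive operators that do not increase the mass are contractions of `ℓ¹`. -/
theorem l1Seminorm_le_of_nonneg {T : (V → ℝ) →L[ℝ] (V → ℝ)} (hT : ∀ f, 0 ≤ f → 0 ≤ T f)
    (hm : ∀ f, G.mass (T f) = G.mass f) (f : V → ℝ) : G.l1Seminorm (T f) ≤ G.l1Seminorm f := by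
  have h : ∀ x, |T f x| ≤ T |f| x := fun x => by
    rw [abs_le]
    have h1 := hT (|f| + f) (fun y => by
      simp only [Pi.add_apply, Pi.abs_apply, Pi.zero_apply]; linarith [neg_abs_le (f y)]) x
    have h2 := hT (|f| - f) (fun y => by
      simp only [Pi.sub_apply, Pi.abs_apply, Pi.zero_apply]; linarith [le_abs_self (f y)]) x
    rw [map_add] at h1
    rw [map_sub] at h2
    simp only [Pi.add_apply, Pi.sub_apply, Pi.zero_apply] at h1 h2
    constructor <;> linarith
  calc G.l1Seminorm (T f) ≤ ∑ x, G.m x * T |f| x :=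
        Finset.sum_le_sum fun x _ => mul_le_mul_of_nonneg_left (h x) (G.m_pos x).le
    _ = G.mass |f| := by rw [← mass_apply, hm]
    _ = G.l1Seminorm f := by rw [mass_apply]; rfl

/-- For `c` at least every weighted degree over `m`, the matrix `c - L` has nonnegative entries; the
shift by `c` only contributes a positive scalar factor. -/
theorem exp_lapL_nonneg {t : ℝ} (ht : 0 ≤ t) {f : V → ℝ} (hf : 0 ≤ f) :
    0 ≤ NormedSpace.exp (-t • G.lapL) f := by
  -- The sum serves as a convenient upper bound for the maximum.
  set c : ℝ := ∑ x, (∑ y, G.b x y) / G.m x with hc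
  have hcx : ∀ x, (∑ y, G.b x y) / G.m x ≤ c := fun x =>
    Finset.single_le_sum (f := fun x => (∑ y, G.b x y) / G.m x)
      (fun z _ => div_nonneg (Finset.sum_nonneg fun y _ => G.b_nonneg z y) (G.m_pos z).le)
      (Finset.mem_univ x)
  have e : -t • G.lapL = (-(t * c)) • (1 : (V → ℝ) →L[ℝ] (V → ℝ)) + t • (c • 1 - G.lapL) := by
    module
  rw [e, exp_add_scalar, smul_apply]
  refine smul_nonneg (Real.exp_pos _).le (exp_nonneg (fun g hg => ?_) hf)
  rw [smul_apply]
  refine smul_nonneg ht fun x => ?_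
  have hx := G.m_pos x
  have e2 : (c • (1 : (V → ℝ) →L[ℝ] (V → ℝ)) - G.lapL) g x =
      (c - (∑ y, G.b x y) / G.m x) * g x + 1 / G.m x * ∑ y, G.b x y * g y := by
    change c * g x - G.lapL g x = _
    rw [lapL_apply]
    simp only [mul_sub, Finset.sum_sub_distrib, ← Finset.sum_mul]
    ring
  rw [e2]
  exact add_nonneg (mul_nonneg (sub_nonneg.2 (hcx x)) (hg x)) (mul_nonneg (by positivity)
    (Finset.sum_nonneg fun y _ => mul_nonneg (G.b_nonneg x y) (hg y)))

theorem mass_exp_lapL (t : ℝ) (f : V → ℝ) :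
    G.mass (NormedSpace.exp (-t • G.lapL) f) = G.mass f :=
  map_exp_of_comp_eq_zero _ (fun g => by rw [smul_apply, map_smul, mass_lapL, smul_zero]) f

theorem l1Seminorm_exp_lapL_le {t : ℝ} (ht : 0 ≤ t) (f : V → ℝ) :
    G.l1Seminorm (NormedSpace.exp (-t • G.lapL) f) ≤ G.l1Seminorm f :=
  G.l1Seminorm_le_of_nonneg (fun _ => G.exp_lapL_nonneg ht) (G.mass_exp_lapL t) f

/-- The minimum principle for the Laplacian with a positive potential. -/
theorem nonneg_of_lapL_add_mul_nonneg {κ u : V → ℝ} (hκ : ∀ x, 0 < κ x)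
    (h : ∀ x, 0 ≤ G.lapL u x + κ x * u x) : 0 ≤ u := by
  intro z
  have : Nonempty V := ⟨z⟩
  -- At a minimum the Laplacian is nonpositive, so the potential term, and with it the minimal
  -- value, must be nonnegative.
  obtain ⟨x, hx⟩ := Finite.exists_min u
  have h1 : G.lapL u x ≤ 0 := by
    rw [lapL_apply]
    refine mul_nonpos_of_nonneg_of_nonpos (by have := G.m_pos x; positivity)
      (Finset.sum_nonpos fun y _ => mul_nonpos_of_nonneg_of_nonpos (G.b_nonneg x y) ?_)
    linarith [hx y]
  have h2 : 0 ≤ κ x * u x := by linarith [h x]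
  exact (nonneg_of_mul_nonneg_right h2 (hκ x)).trans (hx z)

theorem exists_resolvent {α : ℝ} (hα : 0 < α) : ∃ R : (V → ℝ) →L[ℝ] (V → ℝ),
    (∀ f, G.lapL (R f) + α • R f = f) ∧ ∀ f, R (G.lapL f) + α • R f = f := by
  set B : (V → ℝ) →ₗ[ℝ] (V → ℝ) := G.finiteLaplacian + α • LinearMap.id with hB
  have hBa : ∀ u, B u = G.lapL u + α • u := fun u => rfl
  have hinj : Function.Injective B := by
    refine (injective_iff_map_eq_zero B).2 fun u hu => ?_
    rw [hBa] at hu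
    have h1 : 0 ≤ u := G.nonneg_of_lapL_add_mul_nonneg (fun _ => hα) fun x =>
      (congrFun hu x).ge
    have h2 : 0 ≤ -u := G.nonneg_of_lapL_add_mul_nonneg (fun _ => hα) fun x => by
      have := congrFun hu x
      simp only [Pi.add_apply, Pi.smul_apply, smul_eq_mul, Pi.zero_apply] at this
      rw [map_neg, Pi.neg_apply, Pi.neg_apply]
      linarith
    exact le_antisymm (neg_nonneg.1 h2) h1
  set e := LinearEquiv.ofInjectiveEndo B hinj with he
  refine ⟨LinearMap.toContinuousLinearMap e.symm.toLinearMap, fun f => ?_, fun f => ?_⟩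
  · exact (hBa _).symm.trans (e.apply_symm_apply f)
  · have h := e.symm_apply_apply f
    change e.symm (B f) = f at h
    rw [hBa, map_add, map_smul] at h
    exact h

/-! ### Resolvents and Yosida approximations of a finite graph in `ℓ¹` -/

variable {G} {α : ℝ} {R : (V → ℝ) →L[ℝ] (V → ℝ)}

theorem resolvent_nonneg (hα : 0 < α) (hR : ∀ f, G.lapL (R f) + α • R f = f) {f : V → ℝ}
    (hf : 0 ≤ f) : 0 ≤ R f :=
  G.nonneg_of_lapL_add_mul_nonneg (fun _ => hα) fun x => (hf x).trans_eq (congrFun (hR f) x).symm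

theorem mass_smul_resolvent (hR : ∀ f, G.lapL (R f) + α • R f = f) (f : V → ℝ) :
    G.mass ((α • R) f) = G.mass f := by
  nth_rewrite 2 [← hR f]
  rw [map_add, mass_lapL, zero_add]
  rfl

theorem l1Seminorm_smul_resolvent_le (hα : 0 < α) (hR : ∀ f, G.lapL (R f) + α • R f = f)
    (f : V → ℝ) : G.l1Seminorm ((α • R) f) ≤ G.l1Seminorm f :=
  G.l1Seminorm_le_of_nonneg (fun _ hg => smul_nonneg hα.le (resolvent_nonneg hα hR hg))
    (mass_smul_resolvent hR) f

theorem l1Seminorm_exp_yosida_le (hα : 0 < α) (hR : ∀ f, G.lapL (R f) + α • R f = f) {t : ℝ}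
    (ht : 0 ≤ t) (f : V → ℝ) :
    G.l1Seminorm (NormedSpace.exp (-t • (α • (1 - α • R))) f) ≤ G.l1Seminorm f := by
  refine G.l1Seminorm_le_of_nonneg (fun g hg => ?_) (fun g => ?_) f
  · rw [exp_yosida, smul_apply]
    refine smul_nonneg (Real.exp_pos _).le (exp_nonneg (fun h hh => ?_) hg)
    rw [smul_apply, smul_apply]
    exact smul_nonneg (by positivity) (smul_nonneg hα.le (resolvent_nonneg hα hR hh))
  · refine map_exp_of_comp_eq_zero _ (fun h => ?_) g
    change G.mass (-t • α • (h - (α • R) h)) = 0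
    rw [map_smul, map_smul, map_sub, mass_smul_resolvent hR, sub_self, smul_zero, smul_zero]

variable [DecidableEq V]

theorem m_mul_abs_lapL_single_le (x y : V) :
    G.m x * |G.lapL (Pi.single y 1) x| ≤ G.b y x + if x = y then ∑ z, G.b y z else 0 := by
  rw [← abs_of_pos (G.m_pos x), ← abs_mul, m_mul_lapL_apply]
  have e : ∑ z, G.b x z * ((Pi.single y 1 : V → ℝ) x - (Pi.single y 1 : V → ℝ) z) =
      (if x = y then ∑ z, G.b y z else 0) - G.b y x := by
    simp only [mul_sub, Finset.sum_sub_distrib]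
    congr 1
    · split_ifs with h
      · subst h; simp
      · simp [Pi.single_eq_of_ne h]
    · rw [Finset.sum_eq_single y (fun z _ hz => by simp [hz]) (by simp), Pi.single_eq_same, mul_one,
        G.b_symm]
  have h1 : 0 ≤ (if x = y then ∑ z, G.b y z else 0) := by
    split_ifs
    · exact Finset.sum_nonneg fun z _ => G.b_nonneg y z
    · exact le_rfl
  rw [e, abs_le]
  constructor <;> linarith [G.b_nonneg y x]

theorem l1Seminorm_lapL_single_le (y : V) :
    G.l1Seminorm (G.lapL (Pi.single y 1)) ≤ 2 * ∑ z, G.b y z := by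
  refine (Finset.sum_le_sum fun x _ => m_mul_abs_lapL_single_le x y).trans_eq ?_
  rw [Finset.sum_add_distrib, Finset.sum_ite_eq' Finset.univ y, if_pos (Finset.mem_univ y)]
  ring

/-- The bound `2` comes from contractivity of `α R`, the other from `1 - α R = R L` and the `ℓ¹`
norm of `L 1_x`. The second decays in `α` but not uniformly in `x`; the first supplies the
domination. -/
theorem l1Seminorm_single_sub_resolvent_le (hα : 0 < α) (hR : ∀ f, G.lapL (R f) + α • R f = f)
    (hR' : ∀ f, R (G.lapL f) + α • R f = f) (x : V) :
    G.l1Seminorm (Pi.single x 1 - (α • R) (Pi.single x 1)) ≤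
      G.m x * min 2 (2 * (∑ z, G.b x z) / (α * G.m x)) := by
  have hm := G.m_pos x
  rw [mul_min_of_nonneg _ _ hm.le]
  refine le_min ?_ ?_
  · refine (map_sub_le_add _ _ _).trans ?_
    have h := l1Seminorm_smul_resolvent_le hα hR (Pi.single x 1)
    rw [l1Seminorm_single] at h ⊢
    linarith
  · have e : Pi.single x 1 - (α • R) (Pi.single x 1) =
        α⁻¹ • (α • R) (G.lapL (Pi.single x 1)) := by
      rw [smul_apply, smul_apply, inv_smul_smul₀ hα.ne', sub_eq_iff_eq_add]
      exact (hR' _).symm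
    rw [e, map_smul_eq_mul, Real.norm_of_nonneg (by positivity)]
    calc α⁻¹ * _ ≤ α⁻¹ * (2 * ∑ z, G.b x z) := mul_le_mul_of_nonneg_left
          ((l1Seminorm_smul_resolvent_le hα hR _).trans (l1Seminorm_lapL_single_le x))
          (by positivity)
      _ = _ := by field_simp

/-- The speed of convergence in `ℓ¹` of the Yosida approximations. -/
theorem l1Seminorm_exp_sub_exp_yosida_le (hα : 0 < α) (hR : ∀ f, G.lapL (R f) + α • R f = f)
    (hR' : ∀ f, R (G.lapL f) + α • R f = f) {t : ℝ} (ht : 0 < t) (y : V) :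
    G.l1Seminorm (NormedSpace.exp (-t • G.lapL) (Pi.single y 1) -
        NormedSpace.exp (-t • (α • (1 - α • R))) (Pi.single y 1)) ≤
      t * ∑ x, (G.b y x + if x = y then ∑ z, G.b y z else 0) *
        min 2 (2 * (∑ z, G.b x z) / (α * G.m x)) := by
  have hcomm : Commute G.lapL R := by
    ext1 f
    have h1 := hR f
    have h2 := hR' f
    rw [← eq_sub_iff_add_eq] at h1 h2
    exact h1.trans h2.symm
  have hc : Commute G.lapL (α • (1 - α • R)) :=
    ((Commute.one_right _).sub_right (hcomm.smul_right α)).smul_right α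
  refine (seminorm_exp_sub_exp_le _ G.continuous_l1Seminorm hc
    (fun s hs => G.l1Seminorm_exp_lapL_le hs)
    (fun s hs => l1Seminorm_exp_yosida_le hα hR hs) ht _).trans ?_
  refine mul_le_mul_of_nonneg_left ?_ ht.le
  set g := G.lapL (Pi.single y 1) with hg
  -- The Yosida approximation of `L 1_y` is `α R L 1_y`, so the difference of the generators is `1 -
  -- α R` applied to `g = L 1_y`, which is expanded over vertices.
  have e : g - (α • (1 - α • R)) (Pi.single y 1) =
      ∑ x, g x • (Pi.single x 1 - (α • R) (Pi.single x 1)) := by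
    have e1 : (α • (1 - α • R)) (Pi.single y 1) = (α • R) g := by
      change α • (Pi.single y 1 - α • R (Pi.single y 1)) = α • R g
      rw [hg, ← eq_sub_iff_add_eq.2 (hR' (Pi.single y 1))]
    have e2 : g = ∑ x, g x • (Pi.single x 1 : V → ℝ) := pi_eq_sum_univ' g
    have e3 : (α • R) g = ∑ x, g x • (α • R) (Pi.single x 1) := by
      nth_rewrite 1 [e2]
      rw [map_sum]
      exact Finset.sum_congr rfl fun x _ => map_smul _ _ _
    rw [e1, e3]
    nth_rewrite 1 [e2]
    rw [← Finset.sum_sub_distrib]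
    exact Finset.sum_congr rfl fun x _ => (smul_sub _ _ _).symm
  rw [e]
  refine (Finset.le_sum_of_subadditive G.l1Seminorm (map_zero _).le (map_add_le_add _) _ _).trans ?_
  refine Finset.sum_le_sum fun x _ => ?_
  rw [map_smul_eq_mul, Real.norm_eq_abs]
  have hm := G.m_pos x
  calc |g x| * _ ≤ |g x| * (G.m x * min 2 (2 * (∑ z, G.b x z) / (α * G.m x))) :=
        mul_le_mul_of_nonneg_left (l1Seminorm_single_sub_resolvent_le hα hR hR' x) (abs_nonneg _)
    _ = (G.m x * |g x|) * min 2 (2 * (∑ z, G.b x z) / (α * G.m x)) := by ring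
    _ ≤ _ := mul_le_mul_of_nonneg_right (m_mul_abs_lapL_single_le x y)
        (le_min zero_le_two (div_nonneg (mul_nonneg zero_le_two
          (Finset.sum_nonneg fun z _ => G.b_nonneg x z)) (by positivity)))

end Finite

end WeightedGraph

end

noncomputable section

namespace WeightedGraph

open ContractionSemigroup

section Dirichlet

variable {X : Type*} [MeasurableSpace X] [DiscreteMeasurableSpace X] (G : WeightedGraph X)

/-! ### Resolvents of finite sets -/

/-- The rate at which the Dirichlet restriction to `s` is killed. -/
def killing {X : Type*} (G : WeightedGraph X) (s : Finset X) (x : X) : ℝ :=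
  (G.deg x - ∑ y ∈ s, G.b x y) / G.m x

theorem killing_nonneg {X : Type*} (G : WeightedGraph X) (s : Finset X) (x : X) :
    0 ≤ G.killing s x :=
  div_nonneg (sub_nonneg.2 (G.sum_b_le_deg x s)) (G.m_pos x).le

/-- The edges leaving `s`, along which the solution drops to zero, act as a killing term added to
the Neumann Laplacian of `s`. -/
theorem lapL_formResolvent {α : ℝ} (hα : 0 < α) (s : Finset X) (f : G.ell2) (x : s) :
    (G.induce s).lapL (fun y : s => G.formResolvent α s f y) x +
      (α + G.killing s x) * G.formResolvent α s f x = f x := by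
  have hm := G.m_pos x
  have h := G.formResolvent_equation hα s f x.2
  rw [lapL_apply]
  change 1 / G.m x * ∑ y : s, G.b x y * (G.formResolvent α s f x - G.formResolvent α s f y) + _ = _
  rw [Finset.sum_coe_sort s
    (fun y => G.b x y * (G.formResolvent α s f x - G.formResolvent α s f y))]
  simp only [mul_sub, Finset.sum_sub_distrib, ← Finset.sum_mul, killing]
  field_simp
  linarith

theorem formResolvent_finset_nonneg {α : ℝ} (hα : 0 < α) (s : Finset X) {f : G.ell2}
    (hf : ∀ x, 0 ≤ f x) (x : X) : 0 ≤ G.formResolvent α s f x := by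
  by_cases hx : x ∈ s
  · exact (G.induce s).nonneg_of_lapL_add_mul_nonneg (κ := fun x => α + G.killing s x)
      (u := fun y : s => G.formResolvent α s f y)
      (fun x => add_pos_of_pos_of_nonneg hα (G.killing_nonneg s x))
      (fun x => (hf x).trans_eq (G.lapL_formResolvent hα s f x).symm) ⟨x, hx⟩
  · exact (G.formResolvent_apply_of_notMem α f (by exact_mod_cast hx)).ge

theorem smul_formResolvent_finset_le_one {α : ℝ} (hα : 0 < α) (s : Finset X) {f : G.ell2}
    (hf : ∀ x, f x ≤ 1) (x : X) : α * G.formResolvent α s f x ≤ 1 := by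
  by_cases hx : x ∈ s
  · have h := (G.induce s).nonneg_of_lapL_add_mul_nonneg (κ := fun x => α + G.killing s x)
      (u := fun y : s => 1 - α * G.formResolvent α s f y)
      (fun x => add_pos_of_pos_of_nonneg hα (G.killing_nonneg s x)) (fun x => ?_) ⟨x, hx⟩
    · exact sub_nonneg.1 h
    · have h1 := G.lapL_formResolvent hα s f x
      have h2 : (G.induce s).lapL (fun y : s => 1 - α * G.formResolvent α s f y) x =
          -α * (G.induce s).lapL (fun y : s => G.formResolvent α s f y) x := by
        rw [lapL_apply, lapL_apply, mul_left_comm, Finset.mul_sum _ _ (-α)]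
        congr 1
        exact Finset.sum_congr rfl fun y _ => by ring
      rw [h2]
      have h3 := hf x
      have h4 := G.killing_nonneg s x
      nlinarith [mul_le_mul_of_nonneg_left h3 hα.le]
  · rw [G.formResolvent_apply_of_notMem α f (by exact_mod_cast hx), mul_zero]
    exact zero_le_one

/-- The resolvent of the Dirichlet restriction is dominated by that of the Neumann restriction. -/
theorem formResolvent_finset_le {α : ℝ} (hα : 0 < α) (s : Finset X)
    {R : (s → ℝ) →L[ℝ] (s → ℝ)} (hR : ∀ f, (G.induce s).lapL (R f) + α • R f = f)
    {f : G.ell2} (hf : ∀ x, 0 ≤ f x) {g : s → ℝ} (hfg : ∀ x : s, f x ≤ g x) (x : s) :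
    G.formResolvent α s f x ≤ R g x := by
  have h := (G.induce s).nonneg_of_lapL_add_mul_nonneg (κ := fun _ => α)
      (u := R g - fun y : s => G.formResolvent α s f y) (fun _ => hα) (fun x => ?_) x
  · exact sub_nonneg.1 h
  · have h1 := G.lapL_formResolvent hα s f x
    have h2 : (G.induce s).lapL (R g) x + α * R g x = g x := congrFun (hR g) x
    rw [map_sub, Pi.sub_apply, Pi.sub_apply]
    -- Applying `L + α` to the difference of the two solutions gives `g - f` plus the killing term,
    -- both nonnegative.
    have h3 := mul_nonneg (G.killing_nonneg s x) (G.formResolvent_finset_nonneg hα s hf x)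
    linarith [hfg x]

end Dirichlet

section Semigroup

variable {X : Type*} [MeasurableSpace X] [DiscreteMeasurableSpace X] (G : WeightedGraph X)

theorem exists_monotone_exhaustion (X : Type*) [Countable X] :
    ∃ K : ℕ → Finset X, Monotone K ∧ ∀ x, ∃ k, x ∈ K k := by
  classical
  obtain ⟨e, he⟩ := exists_injective_nat X
  refine ⟨fun k => (Set.Finite.preimage (s := Set.Iio k) he.injOn (Set.finite_Iio k)).toFinset,
    fun i j hij x hx => ?_, fun x => ⟨e x + 1, by simp⟩⟩
  simp only [Set.Finite.mem_toFinset, Set.mem_preimage, Set.mem_Iio] at hx ⊢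
  exact hx.trans_le hij

/-! ### The Dirichlet semigroup on `ℓ²(X, m)` -/

/-- The semigroup of the Yosida approximation at `α` of the restriction to `S`. -/
def yosidaSemigroup (t α : ℝ) (S : Set X) : G.ell2 →L[ℝ] G.ell2 :=
  NormedSpace.exp (-t • (α • (1 - α • G.formResolvent α S)))

theorem norm_yosidaSemigroup_apply_le {t α : ℝ} (ht : 0 ≤ t) (hα : 0 < α) (S : Set X)
    (f : G.ell2) : ‖G.yosidaSemigroup t α S f‖ ≤ ‖f‖ :=
  norm_exp_yosida_apply_le ht hα.le (G.norm_smul_formResolvent_apply_le hα S) f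

theorem hasSum_yosidaSemigroup (t α : ℝ) (S : Set X) (f : G.ell2) (x : X) :
    HasSum (fun n : ℕ => Real.exp (-(t * α)) * ((t * α) ^ n / n.factorial) *
      ((α • G.formResolvent α S) ^ n) f x) (G.yosidaSemigroup t α S f x) := by
  have h := (hasSum_exp_yosida t α (G.formResolvent α S) f).mapL (G.evalL x)
  simp only [evalL_apply, map_smul, smul_eq_mul] at h
  exact h

/-- Guarantees that the `limUnder` defining the Dirichlet semigroup is a genuine limit and not a
default value. -/
theorem tendsto_yosidaSemigroup {t : ℝ} (ht : 0 < t) (f : G.ell2) :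
    Tendsto (fun α => G.yosidaSemigroup t α Set.univ f) atTop
      (𝓝 (G.dirichletSemigroupL2 t f)) := by
  obtain ⟨g, hg⟩ := exists_tendsto_exp_yosida_apply (R := fun α => G.formResolvent α Set.univ)
    (fun α β hα hβ => G.formResolvent_eq_add hα hβ)
    (fun α hα => G.norm_smul_formResolvent_apply_le hα Set.univ)
    (G.denseRange_formResolvent one_pos) ht f
  have h : Tendsto (fun α : ℝ => NormedSpace.exp (-t • G.dirichletYosida α) f) atTop (𝓝 g) := by
    refine hg.congr' ?_
    filter_upwards [eventually_gt_atTop 0] with α hα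
    rw [dirichletYosida, G.dirichletResolvent_eq hα]
  rw [dirichletSemigroupL2, h.limUnder_eq]
  exact hg

theorem inner_smul_formResolvent_pow (α : ℝ) (S : Set X) (n : ℕ) (f g : G.ell2) :
    inner ℝ (((α • G.formResolvent α S) ^ n) f) g =
      inner ℝ f (((α • G.formResolvent α S) ^ n) g) := by
  induction n generalizing f g with
  | zero => rfl
  | succ n ih =>
    have e1 : ((α • G.formResolvent α S) ^ (n + 1)) f =
        ((α • G.formResolvent α S) ^ n) ((α • G.formResolvent α S) f) := by rw [pow_succ]; rfl
    have e2 : ((α • G.formResolvent α S) ^ (n + 1)) g =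
        (α • G.formResolvent α S) (((α • G.formResolvent α S) ^ n) g) := by rw [pow_succ']; rfl
    rw [e1, e2, ih, smul_apply, smul_apply, real_inner_smul_left, real_inner_smul_right,
      inner_formResolvent]

theorem inner_yosidaSemigroup (t α : ℝ) (S : Set X) (f g : G.ell2) :
    inner ℝ (G.yosidaSemigroup t α S f) g = inner ℝ f (G.yosidaSemigroup t α S g) := by
  have h1 := (hasSum_exp_yosida t α (G.formResolvent α S) f).mapL (innerSL ℝ g)
  have h2 := (hasSum_exp_yosida t α (G.formResolvent α S) g).mapL (innerSL ℝ f)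
  simp only [innerSL_apply_apply, real_inner_smul_right] at h1 h2
  simp only [real_inner_comm _ g, inner_smul_formResolvent_pow] at h1
  exact h1.unique h2

theorem inner_dirichletSemigroupL2 {t : ℝ} (ht : 0 < t) (f g : G.ell2) :
    inner ℝ (G.dirichletSemigroupL2 t f) g = inner ℝ f (G.dirichletSemigroupL2 t g) := by
  have h1 := (G.tendsto_yosidaSemigroup ht f).inner (𝕜 := ℝ) (tendsto_const_nhds (x := g))
  have h2 := (tendsto_const_nhds (x := f)).inner (𝕜 := ℝ) (G.tendsto_yosidaSemigroup ht g)
  simp only [inner_yosidaSemigroup] at h1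
  exact tendsto_nhds_unique h1 h2

theorem dirichletSemigroupL2_sum {t : ℝ} (ht : 0 < t) {ι : Type*} (s : Finset ι)
    (f : ι → G.ell2) :
    G.dirichletSemigroupL2 t (∑ i ∈ s, f i) = ∑ i ∈ s, G.dirichletSemigroupL2 t (f i) := by
  refine tendsto_nhds_unique (G.tendsto_yosidaSemigroup ht _) ?_
  simp only [map_sum]
  exact tendsto_finsetSum _ fun i _ => G.tendsto_yosidaSemigroup ht (f i)

theorem dirichletSemigroupL2_add {s t : ℝ} (hs : 0 < s) (ht : 0 < t) (f : G.ell2) :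
    G.dirichletSemigroupL2 (s + t) f =
      G.dirichletSemigroupL2 s (G.dirichletSemigroupL2 t f) := by
  refine tendsto_nhds_unique (G.tendsto_yosidaSemigroup (add_pos hs ht) f) ?_
  set g := G.dirichletSemigroupL2 t f with hg
  have e : ∀ α, G.yosidaSemigroup (s + t) α Set.univ f =
      G.yosidaSemigroup s α Set.univ (G.yosidaSemigroup t α Set.univ f - g) +
        G.yosidaSemigroup s α Set.univ g := fun α => by
    rw [← map_add, sub_add_cancel, yosidaSemigroup, neg_add, exp_add_smul]
    rfl
  simp only [e]
  rw [← zero_add (G.dirichletSemigroupL2 s g)]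
  refine Tendsto.add ?_ (G.tendsto_yosidaSemigroup hs g)
  have h0 : Tendsto (fun α => ‖G.yosidaSemigroup t α Set.univ f - g‖) atTop (𝓝 0) := by
    simpa [← hg] using ((G.tendsto_yosidaSemigroup ht f).sub_const g).norm
  refine squeeze_zero_norm' ?_ h0
  filter_upwards [eventually_gt_atTop 0] with α hα
  exact G.norm_yosidaSemigroup_apply_le hs.le hα _ _

/-! ### The heat kernel -/

/-- The kernel `P_t 1_y (x)` with values in `[0, ∞]`. -/
def heat (t : ℝ) (x y : X) : ℝ≥0∞ := ENNReal.ofReal (G.dirichletSemigroupL2 t (G.delta y) x)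

theorem delta_mem_Icc (x y : X) : G.delta y x ∈ Set.Icc (0 : ℝ) 1 := by
  by_cases h : x = y
  · subst h; simp [delta_self]
  · simp [G.delta_of_ne h]

theorem m_mul_dirichletSemigroupL2_delta {t : ℝ} (ht : 0 < t) (x y : X) :
    G.m x * G.dirichletSemigroupL2 t (G.delta y) x =
      G.m y * G.dirichletSemigroupL2 t (G.delta x) y := by
  rw [← inner_delta, ← inner_delta, ← inner_dirichletSemigroupL2 G ht, real_inner_comm]

variable [Countable X]

/-- The Markov property holds for finite sets by the minimum principle and passes to pointwise
limits along an exhaustion. -/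
theorem formResolvent_mem_Icc {α : ℝ} (hα : 0 < α) {f : G.ell2}
    (hf : ∀ x, f x ∈ Set.Icc (0 : ℝ) 1) (x : X) :
    (α • G.formResolvent α Set.univ) f x ∈ Set.Icc (0 : ℝ) 1 := by
  obtain ⟨K, hK, hK'⟩ := exists_monotone_exhaustion X
  have h := tendsto_coe ((G.tendsto_formResolvent hK hK' α f).const_smul α) x
  refine isClosed_Icc.mem_of_tendsto h (Eventually.of_forall fun k => ?_)
  rw [coe_smul]
  exact ⟨mul_nonneg hα.le (G.formResolvent_finset_nonneg hα _ (fun x => (hf x).1) x),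
    G.smul_formResolvent_finset_le_one hα _ (fun x => (hf x).2) x⟩

theorem dirichletSemigroupL2_mem_Icc {t : ℝ} (ht : 0 < t) {f : G.ell2}
    (hf : ∀ x, f x ∈ Set.Icc (0 : ℝ) 1) (x : X) :
    G.dirichletSemigroupL2 t f x ∈ Set.Icc (0 : ℝ) 1 := by
  refine isClosed_Icc.mem_of_tendsto (tendsto_coe (G.tendsto_yosidaSemigroup ht f) x) ?_
  filter_upwards [eventually_gt_atTop 0] with α hα
  have hn : ∀ (n : ℕ) x, ((α • G.formResolvent α Set.univ) ^ n) f x ∈ Set.Icc (0 : ℝ) 1 := by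
    intro n
    induction n with
    | zero => simpa using hf
    | succ n ih => rw [pow_succ']; exact G.formResolvent_mem_Icc hα ih
  have h := G.hasSum_yosidaSemigroup t α Set.univ f x
  refine ⟨h.nonneg fun n => mul_nonneg (by positivity) (hn n x).1,
    hasSum_le (fun n => ?_) h (hasSum_poisson (t * α))⟩
  exact mul_le_of_le_one_right (by positivity) (hn n x).2

theorem dirichletSemigroupL2_delta_nonneg {t : ℝ} (ht : 0 < t) (x y : X) :
    0 ≤ G.dirichletSemigroupL2 t (G.delta y) x :=
  (G.dirichletSemigroupL2_mem_Icc ht (fun z => G.delta_mem_Icc z y) x).1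

theorem tsum_heat_le_one {t : ℝ} (ht : 0 < t) (x : X) : ∑' y, G.heat t x y ≤ 1 := by
  classical
  rw [ENNReal.tsum_eq_iSup_sum]
  refine iSup_le fun s => ?_
  simp only [heat]
  rw [← ENNReal.ofReal_sum_of_nonneg fun y _ => G.dirichletSemigroupL2_delta_nonneg ht x y,
    ← coe_sum, ← G.dirichletSemigroupL2_sum ht]
  refine ENNReal.ofReal_le_one.2 (G.dirichletSemigroupL2_mem_Icc ht (fun z => ?_) x).2
  rw [coe_sum]
  by_cases hz : z ∈ s
  · rw [Finset.sum_eq_single z (fun y _ hy => G.delta_of_ne hy.symm) (fun h => absurd hz h),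
      delta_self]
    simp
  · rw [Finset.sum_eq_zero fun y hy => G.delta_of_ne (by rintro rfl; exact hz hy)]
    simp

theorem summable_dirichletSemigroupL2_delta {t : ℝ} (ht : 0 < t) (x : X) :
    Summable fun y => G.dirichletSemigroupL2 t (G.delta y) x := by
  have h := ENNReal.summable_toReal (ne_top_of_le_ne_top ENNReal.one_ne_top
    (G.tsum_heat_le_one ht x))
  simpa only [heat, ENNReal.toReal_ofReal (G.dirichletSemigroupL2_delta_nonneg ht x _)] using h

theorem dirichletSemigroup_one_eq_iff {t : ℝ} (ht : 0 < t) :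
    (G.dirichletSemigroup t (fun _ => 1) = fun _ => 1) ↔ ∀ x, ∑' y, G.heat t x y = 1 := by
  rw [funext_iff]
  refine forall_congr' fun x => ?_
  simp only [dirichletSemigroup, heat, one_mul]
  rw [← ENNReal.ofReal_tsum_of_nonneg (G.dirichletSemigroupL2_delta_nonneg ht x)
    (G.summable_dirichletSemigroupL2_delta ht x), ENNReal.ofReal_eq_one]

/-- Chapman–Kolmogorov: pair `P_s (P_t 1_y)` with `1_x`, move `P_s` to the other side, and use the
symmetry of the kernel with respect to `m`. -/
theorem heat_add {s t : ℝ} (hs : 0 < s) (ht : 0 < t) (x y : X) :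
    G.heat (s + t) x y = ∑' z, G.heat s x z * G.heat t z y := by
  set f := G.dirichletSemigroupL2 t (G.delta y) with hf
  have hm := G.m_pos x
  have h : HasSum (fun z => G.dirichletSemigroupL2 s (G.delta z) x * f z)
      (G.dirichletSemigroupL2 (s + t) (G.delta y) x) := by
    rw [dirichletSemigroupL2_add G hs ht]
    have h1 := (G.hasSum_inner (G.dirichletSemigroupL2 s (G.delta x)) f).mul_left (G.m x)⁻¹
    rw [inner_dirichletSemigroupL2 G hs, inner_delta, inv_mul_cancel_left₀ hm.ne'] at h1
    have e : ∀ z, G.dirichletSemigroupL2 s (G.delta z) x * f z =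
        (G.m x)⁻¹ * (G.m z * (G.dirichletSemigroupL2 s (G.delta x) z * f z)) := fun z => ?_
    · simp only [e]
      exact h1
    rw [← mul_assoc (G.m z), ← m_mul_dirichletSemigroupL2_delta G hs x z]
    field_simp
  have hnn : ∀ z, 0 ≤ G.dirichletSemigroupL2 s (G.delta z) x * f z := fun z =>
    mul_nonneg (G.dirichletSemigroupL2_delta_nonneg hs x z)
      (G.dirichletSemigroupL2_delta_nonneg ht z y)
  rw [heat, ← h.tsum_eq, ENNReal.ofReal_tsum_of_nonneg hnn h.summable]
  exact tsum_congr fun z => ENNReal.ofReal_mul (G.dirichletSemigroupL2_delta_nonneg hs x z)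

theorem tsum_heat_add {s t : ℝ} (hs : 0 < s) (ht : 0 < t) (x : X) :
    ∑' y, G.heat (s + t) x y = ∑' z, G.heat s x z * ∑' y, G.heat t z y := by
  simp only [G.heat_add hs ht]
  rw [ENNReal.tsum_comm]
  simp only [ENNReal.tsum_mul_left]

/-- Conservation of mass at one time implies conservation of mass at all times. -/
theorem tsum_heat_eq_one_of_exists {s : ℝ} (hs : 0 < s) (h : ∀ x, ∑' y, G.heat s x y = 1)
    {r : ℝ} (hr : 0 < r) (x : X) : ∑' y, G.heat r x y = 1 := by
  have hmul : ∀ n : ℕ, ∀ x, ∑' y, G.heat ((n + 1 : ℕ) * s) x y = 1 := by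
    intro n
    induction n with
    | zero => simpa using h
    | succ n ih =>
      intro x
      have e : ((n + 1 + 1 : ℕ) : ℝ) * s = (n + 1 : ℕ) * s + s := by push_cast; ring
      rw [e, tsum_heat_add G (by positivity) hs]
      simp only [h, mul_one]
      exact ih x
  -- At a multiple of `s` beyond `r` mass is conserved. Factoring that time through `r` leaves a
  -- sub-Markov remainder, so no mass can have been lost by time `r`.
  obtain ⟨n, hn⟩ := exists_nat_gt (r / s)
  rw [div_lt_iff₀ hs] at hn
  have hlt : 0 < ((n + 1 : ℕ) : ℝ) * s - r := by push_cast; linarith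
  refine le_antisymm (G.tsum_heat_le_one hr x) ?_
  have h1 := hmul n x
  rw [← add_sub_cancel r (((n + 1 : ℕ) : ℝ) * s), tsum_heat_add G hr hlt] at h1
  rw [← h1]
  exact ENNReal.tsum_le_tsum fun z => mul_le_of_le_one_right' (G.tsum_heat_le_one hlt z)

end Semigroup

end WeightedGraph

end

noncomputable section

namespace WeightedGraph

open ContractionSemigroup

section Neumann

/-! ### The Neumann restrictions -/

variable {X : Type*} [MeasurableSpace X] [DiscreteMeasurableSpace X] (G : WeightedGraph X)

theorem neumannRestriction_of_mem {X : Type*} (G : WeightedGraph X) {s : Finset X} (t : ℝ)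
    (f : X → ℝ) {x : X} (hx : x ∈ s) : G.neumannRestriction s t f x =
      NormedSpace.exp (-t • (G.induce s).lapL) (fun y : s => f y) ⟨x, hx⟩ := by
  rw [neumannRestriction, dif_pos hx]

theorem neumannRestriction_of_notMem {X : Type*} (G : WeightedGraph X) {s : Finset X} (t : ℝ)
    (f : X → ℝ) {x : X} (hx : x ∉ s) : G.neumannRestriction s t f x = 0 := by
  rw [neumannRestriction, dif_neg hx]

open Classical in
theorem restrict_delta {s : Finset X} {y : X} (hy : y ∈ s) :
    (fun z : s => G.delta y z) = Pi.single ⟨y, hy⟩ 1 := by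
  funext z
  by_cases h : z = ⟨y, hy⟩
  · subst h
    rw [Pi.single_eq_same, delta_self]
  · rw [Pi.single_eq_of_ne h, G.delta_of_ne fun h' => h (Subtype.ext h')]

theorem neumannRestriction_delta_of_notMem {s : Finset X} (t : ℝ) {y : X} (hy : y ∉ s) (x : X) :
    G.neumannRestriction s t (G.delta y) x = 0 := by
  by_cases hx : x ∈ s
  · have h0 : (fun z : s => G.delta y z) = 0 := by
      funext z
      exact G.delta_of_ne (by rintro h; exact hy (h ▸ z.2))
    rw [neumannRestriction_of_mem _ _ _ hx, h0, map_zero]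
    rfl
  · exact G.neumannRestriction_of_notMem t _ hx

theorem neumannRestriction_delta_nonneg (s : Finset X) {t : ℝ} (ht : 0 < t) (x y : X) :
    0 ≤ G.neumannRestriction s t (G.delta y) x := by
  by_cases hx : x ∈ s
  · rw [neumannRestriction_of_mem _ _ _ hx]
    exact (G.induce s).exp_lapL_nonneg ht.le (fun z => (G.delta_mem_Icc z y).1) ⟨x, hx⟩
  · exact (G.neumannRestriction_of_notMem t _ hx).ge

theorem hasSum_neumannRestriction_delta {s : Finset X} (t : ℝ) {y : X} (hy : y ∈ s) :
    HasSum (fun x => G.m x * G.neumannRestriction s t (G.delta y) x) (G.m y) := by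
  classical
  have h : ∑ x ∈ s, G.m x * G.neumannRestriction s t (G.delta y) x = G.m y := by
    rw [← Finset.sum_coe_sort s]
    have h1 := (G.induce s).mass_exp_lapL t (Pi.single ⟨y, hy⟩ 1)
    have h2 : (G.induce s).mass (Pi.single ⟨y, hy⟩ 1) = G.m y := by
      rw [mass_apply, Finset.sum_eq_single ⟨y, hy⟩
        (fun z _ hz => by rw [Pi.single_eq_of_ne hz, mul_zero]) (by simp), Pi.single_eq_same,
        mul_one]
      rfl
    rw [h2, mass_apply] at h1
    refine (Finset.sum_congr rfl fun x _ => ?_).trans h1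
    rw [neumannRestriction_of_mem _ _ _ x.2, G.restrict_delta hy]
    rfl
  rw [← h]
  exact hasSum_sum_of_ne_finset_zero fun x hx => by
    rw [G.neumannRestriction_of_notMem t _ hx, mul_zero]

theorem hasSum_neumannRestriction (s : Finset X) (t : ℝ) (f : X → ℝ) (x : X) :
    HasSum (fun y => f y * G.neumannRestriction s t (G.delta y) x)
      (G.neumannRestriction s t f x) := by
  classical
  have h : ∑ y ∈ s, f y * G.neumannRestriction s t (G.delta y) x =
      G.neumannRestriction s t f x := by
    by_cases hx : x ∈ s
    · rw [neumannRestriction_of_mem _ _ _ hx, pi_eq_sum_univ' (fun y : s => f y), map_sum,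
        Finset.sum_apply, ← Finset.sum_coe_sort s]
      refine Finset.sum_congr rfl fun y _ => ?_
      rw [neumannRestriction_of_mem _ _ _ hx, G.restrict_delta y.2, map_smul]
      rfl
    · simp only [G.neumannRestriction_of_notMem t _ hx, mul_zero, Finset.sum_const_zero]
  rw [← h]
  exact hasSum_sum_of_ne_finset_zero fun y hy => by
    rw [G.neumannRestriction_delta_of_notMem t hy, mul_zero]

/-! ### Comparison with the Dirichlet semigroup -/

open Classical in
/-- A term of the bound for the error of the Yosida approximation at `α` applied to `1_y`. -/
def yosidaErrorTerm {X : Type*} (G : WeightedGraph X) (α : ℝ) (y x : X) : ℝ :=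
  (G.b y x + if x = y then G.deg y else 0) * min 2 (2 * G.deg x / (α * G.m x))

/-- A bound for the error of the Yosida approximation at `α` applied to `1_y`. -/
def yosidaError {X : Type*} (G : WeightedGraph X) (α : ℝ) (y : X) : ℝ :=
  ∑' x, G.yosidaErrorTerm α y x

open Classical in
theorem yosidaErrorTerm_coeff {X : Type*} (G : WeightedGraph X) (y : X) :
    Summable (fun x => G.b y x + if x = y then G.deg y else 0) ∧
      ∀ x, 0 ≤ G.b y x + if x = y then G.deg y else 0 := by
  refine ⟨(G.b_summable y).add (hasSum_ite_eq y (G.deg y)).summable, fun x => ?_⟩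
  have h1 := G.b_nonneg y x
  have h2 := G.deg_nonneg y
  split_ifs <;> linarith

theorem yosidaErrorTerm_nonneg {X : Type*} (G : WeightedGraph X) {α : ℝ} (hα : 0 < α) (y x : X) :
    0 ≤ G.yosidaErrorTerm α y x :=
  mul_nonneg ((G.yosidaErrorTerm_coeff y).2 x) (le_min zero_le_two
    (div_nonneg (mul_nonneg zero_le_two (G.deg_nonneg x)) (mul_pos hα (G.m_pos x)).le))

open Classical in
theorem yosidaErrorTerm_le {X : Type*} (G : WeightedGraph X) (α : ℝ) (y x : X) :
    G.yosidaErrorTerm α y x ≤ (G.b y x + if x = y then G.deg y else 0) * 2 :=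
  mul_le_mul_of_nonneg_left (min_le_left _ _) ((G.yosidaErrorTerm_coeff y).2 x)

theorem summable_yosidaErrorTerm {X : Type*} (G : WeightedGraph X) {α : ℝ} (hα : 0 < α) (y : X) :
    Summable (G.yosidaErrorTerm α y) :=
  Summable.of_nonneg_of_le (G.yosidaErrorTerm_nonneg hα y) (G.yosidaErrorTerm_le α y)
    ((G.yosidaErrorTerm_coeff y).1.mul_right 2)

/-- The weights `b y x`, together with the diagonal term, are summable, while the minimum is at most
`2` and tends to `0` for each `x`; no bound on the degrees is needed. -/
theorem tendsto_yosidaError {X : Type*} (G : WeightedGraph X) (y : X) :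
    Tendsto (fun α => G.yosidaError α y) atTop (𝓝 0) := by
  classical
  rw [← tsum_zero (α := ℝ) (β := X)]
  refine tendsto_tsum_of_dominated_convergence ((G.yosidaErrorTerm_coeff y).1.mul_right 2)
    (fun x => ?_) ?_
  · have h1 : Tendsto (fun α : ℝ => 2 * G.deg x / (α * G.m x)) atTop (𝓝 0) :=
      tendsto_const_nhds.div_atTop (tendsto_id.atTop_mul_const (G.m_pos x))
    have h2 := ((tendsto_const_nhds (x := (2 : ℝ))).min h1).const_mul
      (G.b y x + if x = y then G.deg y else 0)
    rw [min_eq_right zero_le_two, mul_zero] at h2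
    exact h2
  · filter_upwards [eventually_gt_atTop 0] with α hα x
    rw [Real.norm_of_nonneg (G.yosidaErrorTerm_nonneg hα y x)]
    exact G.yosidaErrorTerm_le α y x

/-- Domination of resolvents passes to powers and Poisson averages, and the Neumann–Yosida semigroup
is then exchanged for the Neumann semigroup. The error does not depend on `s`, since degrees inside
`s` are at most degrees in `X`. -/
theorem yosidaSemigroup_finset_le {t α : ℝ} (ht : 0 < t) (hα : 0 < α) {s : Finset X} {x y : X}
    (hx : x ∈ s) (hy : y ∈ s) :
    G.yosidaSemigroup t α s (G.delta y) x ≤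
      G.neumannRestriction s t (G.delta y) x + t * G.yosidaError α y / G.m x := by
  classical
  obtain ⟨R, hR, hR'⟩ := (G.induce s).exists_resolvent hα
  have hpow : ∀ n : ℕ, (∀ z, 0 ≤ ((α • G.formResolvent α s) ^ n) (G.delta y) z) ∧
      ∀ z : s, ((α • G.formResolvent α s) ^ n) (G.delta y) z ≤
        ((α • R) ^ n) (Pi.single ⟨y, hy⟩ 1) z := by
    intro n
    induction n with
    | zero =>
      refine ⟨fun z => (G.delta_mem_Icc z y).1, fun z => ?_⟩
      rw [← G.restrict_delta hy]
      exact le_rfl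
    | succ n ih =>
      have e1 : ∀ z, ((α • G.formResolvent α s) ^ (n + 1)) (G.delta y) z =
          α * G.formResolvent α s (((α • G.formResolvent α s) ^ n) (G.delta y)) z := fun z => by
        rw [pow_succ', ← coe_smul]; rfl
      have e2 : ∀ z, ((α • R) ^ (n + 1)) (Pi.single ⟨y, hy⟩ 1) z =
          α * R (((α • R) ^ n) (Pi.single ⟨y, hy⟩ 1)) z := fun z => by
        rw [pow_succ']; rfl
      refine ⟨fun z => ?_, fun z => ?_⟩
      · rw [e1]
        exact mul_nonneg hα.le (G.formResolvent_finset_nonneg hα s ih.1 z)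
      · rw [e1, e2]
        exact mul_le_mul_of_nonneg_left (G.formResolvent_finset_le hα s hR ih.1 ih.2 z) hα.le
  set v := NormedSpace.exp (-t • (α • (1 - α • R))) (Pi.single ⟨y, hy⟩ 1) with hv
  set w := NormedSpace.exp (-t • (G.induce s).lapL) (Pi.single ⟨y, hy⟩ 1) with hw
  have h1 : G.yosidaSemigroup t α s (G.delta y) x ≤ v ⟨x, hx⟩ := by
    have hs := (hasSum_exp_yosida t α R (Pi.single ⟨y, hy⟩ 1)).mapL
      (ContinuousLinearMap.proj (R := ℝ) (φ := fun _ : s => ℝ) ⟨x, hx⟩)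
    simp only [map_smul, ContinuousLinearMap.proj_apply, smul_eq_mul] at hs
    exact hasSum_le (fun n => mul_le_mul_of_nonneg_left ((hpow n).2 ⟨x, hx⟩) (by positivity))
      (G.hasSum_yosidaSemigroup t α s (G.delta y) x) hs
  have h2 : G.m x * |w ⟨x, hx⟩ - v ⟨x, hx⟩| ≤ t * G.yosidaError α y := by
    have hle := l1Seminorm_exp_sub_exp_yosida_le hα hR hR' ht ⟨y, hy⟩
    have hone : G.m x * |w ⟨x, hx⟩ - v ⟨x, hx⟩| ≤ (G.induce s).l1Seminorm (w - v) :=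
      Finset.single_le_sum (f := fun z : s => (G.induce s).m z * |(w - v) z|)
        (fun z _ => mul_nonneg ((G.induce s).m_pos z).le (abs_nonneg _))
        (Finset.mem_univ (⟨x, hx⟩ : s))
    refine (hone.trans hle).trans (mul_le_mul_of_nonneg_left ?_ ht.le)
    have hb : ∀ z : s, ∑ z' : s, (G.induce s).b z z' ≤ G.deg z := fun z =>
      (Finset.sum_coe_sort s (fun z' => G.b z z')).trans_le (G.sum_b_le_deg z s)
    calc _ ≤ ∑ z : s, G.yosidaErrorTerm α y z := by
          refine Finset.sum_le_sum fun z _ => ?_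
          have hm := G.m_pos z
          refine mul_le_mul ?_ ?_ ?_ ((G.yosidaErrorTerm_coeff y).2 z)
          · refine add_le_add le_rfl ?_
            by_cases h : z = ⟨y, hy⟩
            · rw [if_pos h, if_pos (congrArg Subtype.val h)]
              exact hb ⟨y, hy⟩
            · rw [if_neg h, if_neg fun h' => h (Subtype.ext h')]
          · refine min_le_min le_rfl ?_
            exact div_le_div_of_nonneg_right (mul_le_mul_of_nonneg_left (hb z) zero_le_two)
              (mul_pos hα hm).le
          · exact le_min zero_le_two (div_nonneg (mul_nonneg zero_le_two
              (Finset.sum_nonneg fun z' _ => (G.induce s).b_nonneg z z')) (mul_pos hα hm).le)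
      _ = ∑ z ∈ s, G.yosidaErrorTerm α y z := Finset.sum_coe_sort s _
      _ ≤ _ := (G.summable_yosidaErrorTerm hα y).sum_le_tsum s
          fun z _ => G.yosidaErrorTerm_nonneg hα y z
  have h3 : v ⟨x, hx⟩ ≤ w ⟨x, hx⟩ + t * G.yosidaError α y / G.m x := by
    have h4 : |w ⟨x, hx⟩ - v ⟨x, hx⟩| ≤ t * G.yosidaError α y / G.m x := by
      rw [le_div_iff₀ (G.m_pos x), mul_comm]
      exact h2
    linarith [(abs_le.1 h4).1]
  rw [neumannRestriction_of_mem _ _ _ hx, G.restrict_delta hy]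
  exact h1.trans h3

/-- The Neumann restrictions asymptotically dominate the Dirichlet semigroup. -/
theorem eventually_le_neumannRestriction {K : ℕ → Finset X} (hmono : Monotone K)
    (hK : ∀ x, ∃ k, x ∈ K k) {t : ℝ} (ht : 0 < t) (x y : X) {ε : ℝ} (hε : 0 < ε) :
    ∀ᶠ k in atTop, G.dirichletSemigroupL2 t (G.delta y) x - ε ≤
      G.neumannRestriction (K k) t (G.delta y) x := by
  have herr : Tendsto (fun α => t * G.yosidaError α y / G.m x) atTop (𝓝 0) := by
    simpa using ((G.tendsto_yosidaError y).const_mul t).div_const (G.m x)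
  have h1 := tendsto_coe (G.tendsto_yosidaSemigroup ht (G.delta y)) x
  -- The parameter `α` is fixed before `k`. The losses are `ε / 4` for the Yosida limit, `ε / 2` for
  -- the Neumann error and `ε / 4` for the exhaustion.
  obtain ⟨α, hα, hα1, hα2⟩ := ((eventually_gt_atTop (0 : ℝ)).and
    ((h1.eventually_const_lt (sub_lt_self _ (half_pos (half_pos hε)))).and
      (herr.eventually_lt_const (half_pos hε)))).exists
  have h2 := tendsto_coe (tendsto_exp_yosida_apply ht.le hα.le
    (fun k => G.norm_smul_formResolvent_apply_le hα (K k))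
    (G.tendsto_formResolvent hmono hK α) (G.delta y)) x
  obtain ⟨i, hi⟩ := hK x
  obtain ⟨j, hj⟩ := hK y
  filter_upwards [h2.eventually_const_lt (sub_lt_self _ (half_pos (half_pos hε))),
    eventually_ge_atTop i, eventually_ge_atTop j] with k hk hik hjk
  have h3 := G.yosidaSemigroup_finset_le ht hα (hmono hik hi) (hmono hjk hj)
  change G.yosidaSemigroup t α Set.univ (G.delta y) x - ε / 2 / 2 <
    G.yosidaSemigroup t α (K k) (G.delta y) x at hk
  linarith

theorem aestronglyMeasurable_measure (f : X → ℝ) : AEStronglyMeasurable f G.measure :=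
  (Measurable.of_discrete).aestronglyMeasurable

end Neumann

end WeightedGraph

end

noncomputable section

namespace WeightedGraph

section Convergence

/-! ### Convergence in `ℓ¹(X, m)` -/

variable {X : Type*} [Countable X] [MeasurableSpace X] [DiscreteMeasurableSpace X]
  (G : WeightedGraph X)

theorem eLpNorm_one_eq_tsum (f : X → ℝ) :
    eLpNorm f 1 G.measure = ∑' x, ENNReal.ofReal (G.m x) * ‖f x‖ₑ := by
  rw [eLpNorm_one_eq_lintegral_enorm, lintegral_countable']
  exact tsum_congr fun x => by rw [measure_singleton, mul_comm]

theorem eLpNorm_one_eq_ofReal {f : X → ℝ} (hf : Summable fun x => G.m x * |f x|) :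
    eLpNorm f 1 G.measure = ENNReal.ofReal (∑' x, G.m x * |f x|) := by
  rw [eLpNorm_one_eq_tsum, ENNReal.ofReal_tsum_of_nonneg
    (fun x => mul_nonneg (G.m_pos x).le (abs_nonneg _)) hf]
  refine tsum_congr fun x => ?_
  rw [ENNReal.ofReal_mul (G.m_pos x).le, ← Real.enorm_eq_ofReal_abs]

/-- The total mass of `P_t 1_y` is `m y (P_t 1) y`. -/
theorem hasSum_m_mul_dirichletSemigroupL2_delta {t : ℝ} (ht : 0 < t) (y : X) :
    HasSum (fun x => G.m x * G.dirichletSemigroupL2 t (G.delta y) x)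
      (G.m y * G.dirichletSemigroup t (fun _ => 1) y) := by
  simp only [G.m_mul_dirichletSemigroupL2_delta ht _ y, dirichletSemigroup, one_mul]
  exact (G.summable_dirichletSemigroupL2_delta ht y).hasSum.mul_left (G.m y)

theorem dirichletSemigroup_one_le_one {t : ℝ} (ht : 0 < t) (y : X) :
    G.dirichletSemigroup t (fun _ => 1) y ≤ 1 := by
  have h := G.tsum_heat_le_one ht y
  simp only [heat] at h
  rw [← ENNReal.ofReal_tsum_of_nonneg (G.dirichletSemigroupL2_delta_nonneg ht y)
    (G.summable_dirichletSemigroupL2_delta ht y), ENNReal.ofReal_le_one] at h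
  simpa only [dirichletSemigroup, one_mul] using h

theorem eLpNorm_dirichletSemigroupL2_delta_le {t : ℝ} (ht : 0 < t) (y : X) :
    eLpNorm (G.dirichletSemigroupL2 t (G.delta y)) 1 G.measure ≤ ENNReal.ofReal (G.m y) := by
  have h := G.hasSum_m_mul_dirichletSemigroupL2_delta ht y
  have e : ∀ x, G.m x * |G.dirichletSemigroupL2 t (G.delta y) x| =
      G.m x * G.dirichletSemigroupL2 t (G.delta y) x := fun x => by
    rw [abs_of_nonneg (G.dirichletSemigroupL2_delta_nonneg ht x y)]
  rw [G.eLpNorm_one_eq_ofReal (by simpa only [e] using h.summable)]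
  simp only [e]
  rw [h.tsum_eq]
  exact ENNReal.ofReal_le_ofReal
    (mul_le_of_le_one_right (G.m_pos y).le (G.dirichletSemigroup_one_le_one ht y))

theorem eLpNorm_neumannRestriction_delta (s : Finset X) {t : ℝ} (ht : 0 < t) {y : X} (hy : y ∈ s) :
    eLpNorm (G.neumannRestriction s t (G.delta y)) 1 G.measure = ENNReal.ofReal (G.m y) := by
  have h := G.hasSum_neumannRestriction_delta t hy
  have e : ∀ x, G.m x * |G.neumannRestriction s t (G.delta y) x| =
      G.m x * G.neumannRestriction s t (G.delta y) x := fun x => by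
    rw [abs_of_nonneg (G.neumannRestriction_delta_nonneg s ht x y)]
  rw [G.eLpNorm_one_eq_ofReal (by simpa only [e] using h.summable)]
  simp only [e]
  rw [h.tsum_eq]

theorem eLpNorm_sub_delta_le (s : Finset X) {t : ℝ} (ht : 0 < t) (y : X) :
    eLpNorm (G.neumannRestriction s t (G.delta y) - ⇑(G.dirichletSemigroupL2 t (G.delta y))) 1
      G.measure ≤ 2 * ENNReal.ofReal (G.m y) := by
  refine (eLpNorm_sub_le (G.aestronglyMeasurable_measure _) (G.aestronglyMeasurable_measure _)
    le_rfl).trans ?_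
  rw [two_mul]
  refine add_le_add ?_ (G.eLpNorm_dirichletSemigroupL2_delta_le ht y)
  by_cases hy : y ∈ s
  · exact (G.eLpNorm_neumannRestriction_delta s ht hy).le
  · have h0 : G.neumannRestriction s t (G.delta y) = 0 :=
      funext (G.neumannRestriction_delta_of_notMem t hy)
    rw [h0, eLpNorm_zero]
    exact zero_le

variable {G}

/-- If no mass is lost, the Neumann restrictions of the semigroup converge on indicators. -/
theorem tendsto_eLpNorm_sub_delta {K : ℕ → Finset X} (hmono : Monotone K)
    (hK : ∀ x, ∃ k, x ∈ K k) {t : ℝ} (ht : 0 < t)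
    (hc : G.dirichletSemigroup t (fun _ => 1) = fun _ => 1) (y : X) :
    Tendsto (fun k => eLpNorm (G.neumannRestriction (K k) t (G.delta y) -
      ⇑(G.dirichletSemigroupL2 t (G.delta y))) 1 G.measure) atTop (𝓝 0) := by
  set w : X → ℝ := ⇑(G.dirichletSemigroupL2 t (G.delta y)) with hw
  set v : ℕ → X → ℝ := fun k => G.neumannRestriction (K k) t (G.delta y) with hv
  have hw0 : ∀ x, 0 ≤ w x := fun x => G.dirichletSemigroupL2_delta_nonneg ht x y
  have hv0 : ∀ k x, 0 ≤ v k x := fun k x => G.neumannRestriction_delta_nonneg (K k) ht x y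
  have hws : HasSum (fun x => G.m x * w x) (G.m y) := by
    simpa [hc] using G.hasSum_m_mul_dirichletSemigroupL2_delta ht y
  have hpos : ∀ k x, 0 ≤ G.m x * max (w x - v k x) 0 := fun k x =>
    mul_nonneg (G.m_pos x).le (le_max_right _ _)
  have hle : ∀ k x, G.m x * max (w x - v k x) 0 ≤ G.m x * w x := fun k x =>
    mul_le_mul_of_nonneg_left (max_le (sub_le_self _ (hv0 k x)) (hw0 x)) (G.m_pos x).le
  -- Scheffé's argument: the positive part of `w - v k` is dominated by the summable `w`, and the
  -- asymptotic lower bound on `v k` sends it to zero pointwise.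
  have hlim : Tendsto (fun k => ∑' x, G.m x * max (w x - v k x) 0) atTop (𝓝 0) := by
    rw [show 𝓝 (0 : ℝ) = 𝓝 (∑' _ : X, 0) by rw [tsum_zero]]
    refine tendsto_tsum_of_dominated_convergence hws.summable (fun x => ?_)
      (Eventually.of_forall fun k x => ?_)
    · rw [show 𝓝 (0 : ℝ) = 𝓝 (G.m x * 0) by rw [mul_zero]]
      refine Tendsto.const_mul _ (tendsto_order.2 ⟨fun a ha => ?_, fun a ha => ?_⟩)
      · exact Eventually.of_forall fun k => ha.trans_le (le_max_right _ _)
      · filter_upwards [G.eventually_le_neumannRestriction hmono hK ht x y (half_pos ha)] with k hk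
        refine max_lt ?_ ha
        have : w x - a / 2 ≤ v k x := hk
        linarith
    · rw [Real.norm_of_nonneg (hpos k x)]
      exact hle k x
  have hlim2 := ENNReal.tendsto_ofReal (hlim.const_mul 2)
  rw [mul_zero, ENNReal.ofReal_zero] at hlim2
  refine hlim2.congr' ?_
  obtain ⟨j, hj⟩ := hK y
  filter_upwards [eventually_ge_atTop j] with k hk
  have hvs : HasSum (fun x => G.m x * v k x) (G.m y) :=
    G.hasSum_neumannRestriction_delta t (hmono hk hj)
  have hps := (Summable.of_nonneg_of_le (hpos k) (hle k) hws.summable).hasSum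
  have h := (hvs.sub hws).add (hps.mul_left 2)
  rw [sub_self, zero_add] at h
  -- Since `v k` and `w` have the same mass, the first two terms cancel after summation and twice
  -- the positive part remains.
  have e : ∀ x, G.m x * |(v k - w) x| =
      G.m x * v k x - G.m x * w x + 2 * (G.m x * max (w x - v k x) 0) := fun x => by
    rw [Pi.sub_apply]
    rcases le_total (v k x) (w x) with h | h
    · rw [abs_of_nonpos (by linarith), max_eq_left (by linarith)]; ring
    · rw [abs_of_nonneg (by linarith), max_eq_right (by linarith)]; ring
  change _ = eLpNorm (v k - w) 1 G.measure
  rw [G.eLpNorm_one_eq_ofReal (by simpa only [e] using h.summable)]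
  simp only [e]
  rw [h.tsum_eq]

/-- If no mass is lost, the Neumann restrictions of the semigroup converge strongly in `ℓ¹`. -/
theorem tendsto_eLpNorm_sub {K : ℕ → Finset X} (hmono : Monotone K)
    (hK : ∀ x, ∃ k, x ∈ K k) {t : ℝ} (ht : 0 < t)
    (hc : G.dirichletSemigroup t (fun _ => 1) = fun _ => 1) {f : X → ℝ}
    (hf : MemLp f 1 G.measure) :
    Tendsto (fun k => eLpNorm (G.neumannRestriction (K k) t f - G.dirichletSemigroup t f) 1
      G.measure) atTop (𝓝 0) := by
  have hfs : ∑' y, ENNReal.ofReal (G.m y) * ‖f y‖ₑ ≠ ∞ := by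
    rw [← eLpNorm_one_eq_tsum]
    exact hf.2.ne
  set D : ℕ → X → ℝ≥0∞ := fun k y => eLpNorm (G.neumannRestriction (K k) t (G.delta y) -
    ⇑(G.dirichletSemigroupL2 t (G.delta y))) 1 G.measure with hD
  -- The kernel is at most `m y / m x` by symmetry and the Markov property, so the series defining
  -- `P_t f` converges absolutely for `f` in `ℓ¹`.
  have hsum : ∀ x, Summable fun y => f y * G.dirichletSemigroupL2 t (G.delta y) x := fun x => by
    refine Summable.of_norm_bounded (g := fun y => (G.m x)⁻¹ * (G.m y * |f y|)) ?_ fun y => ?_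
    · refine Summable.mul_left _ ?_
      have := ENNReal.summable_toReal hfs
      simpa only [ENNReal.toReal_mul, ENNReal.toReal_ofReal (G.m_pos _).le, toReal_enorm,
        Real.norm_eq_abs] using this
    · have hm := G.m_pos x
      have h1 := G.m_mul_dirichletSemigroupL2_delta ht x y
      have h2 := (G.dirichletSemigroupL2_mem_Icc ht (fun z => G.delta_mem_Icc z x) y).2
      have h3 := G.dirichletSemigroupL2_delta_nonneg ht x y
      have h4 : G.dirichletSemigroupL2 t (G.delta y) x ≤ (G.m x)⁻¹ * G.m y := by
        rw [inv_mul_eq_div, le_div_iff₀ hm, mul_comm, h1]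
        exact mul_le_of_le_one_right (G.m_pos y).le h2
      rw [norm_mul, Real.norm_eq_abs, Real.norm_of_nonneg h3]
      calc _ ≤ |f y| * ((G.m x)⁻¹ * G.m y) := mul_le_mul_of_nonneg_left h4 (abs_nonneg _)
        _ = _ := by ring
  have hbound : ∀ k, eLpNorm (G.neumannRestriction (K k) t f - G.dirichletSemigroup t f) 1
      G.measure ≤ ∑' y, ‖f y‖ₑ * D k y := fun k => by
    have e : ∀ x, (G.neumannRestriction (K k) t f - G.dirichletSemigroup t f) x =
        ∑' y, f y * (G.neumannRestriction (K k) t (G.delta y) -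
          ⇑(G.dirichletSemigroupL2 t (G.delta y))) x := fun x => by
      have h1 := G.hasSum_neumannRestriction (K k) t f x
      have h2 := h1.sub (hsum x).hasSum
      rw [Pi.sub_apply, dirichletSemigroup, ← h2.tsum_eq]
      exact tsum_congr fun y => by rw [Pi.sub_apply]; ring
    rw [eLpNorm_one_eq_tsum]
    calc _ ≤ ∑' x, ENNReal.ofReal (G.m x) * ∑' y, ‖f y‖ₑ *
            ‖(G.neumannRestriction (K k) t (G.delta y) -
              ⇑(G.dirichletSemigroupL2 t (G.delta y))) x‖ₑ := by
          refine ENNReal.tsum_le_tsum fun x => mul_le_mul_right ?_ _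
          rw [e]
          refine enorm_tsum_le_tsum_enorm.trans_eq (tsum_congr fun y => enorm_mul _ _)
      _ = ∑' y, ‖f y‖ₑ * D k y := by
          simp only [← ENNReal.tsum_mul_left]
          rw [ENNReal.tsum_comm]
          refine tsum_congr fun y => ?_
          simp only [hD, eLpNorm_one_eq_tsum]
          rw [← ENNReal.tsum_mul_left]
          exact tsum_congr fun x => mul_left_comm _ _ _
  -- Dominated convergence for the counting measure, with majorant `2 * m y * |f y|` from
  -- contractivity of both semigroups in `ℓ¹`.
  have hlim : Tendsto (fun k => ∑' y, ‖f y‖ₑ * D k y) atTop (𝓝 0) := by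
    simp only [← lintegral_count]
    rw [← lintegral_zero (μ := Measure.count) (α := X)]
    refine tendsto_lintegral_of_dominated_convergence
      (fun y => 2 * (ENNReal.ofReal (G.m y) * ‖f y‖ₑ)) (fun k => Measurable.of_discrete)
      (fun k => Eventually.of_forall fun y => ?_) ?_ (Eventually.of_forall fun y => ?_)
    · calc ‖f y‖ₑ * D k y ≤ ‖f y‖ₑ * (2 * ENNReal.ofReal (G.m y)) :=
            mul_le_mul_right (G.eLpNorm_sub_delta_le (K k) ht y) _
        _ = _ := by ring
    · rw [lintegral_count, ENNReal.tsum_mul_left]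
      exact ENNReal.mul_ne_top ENNReal.ofNat_ne_top hfs
    · have := ENNReal.Tendsto.const_mul (tendsto_eLpNorm_sub_delta hmono hK ht hc y)
        (a := ‖f y‖ₑ) (Or.inr enorm_ne_top)
      simpa using this
  exact tendsto_of_tendsto_of_tendsto_of_le_of_le tendsto_const_nhds hlim
    (fun _ => zero_le) hbound

/-- Strong convergence in `ℓ¹` of the Neumann restrictions implies that no mass is lost. -/
theorem dirichletSemigroup_one_of_tendsto {K : ℕ → Finset X} (hmono : Monotone K)
    (hK : ∀ x, ∃ k, x ∈ K k) {t : ℝ} (ht : 0 < t)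
    (h : ∀ f : X → ℝ, MemLp f 1 G.measure →
      Tendsto (fun k => eLpNorm (G.neumannRestriction (K k) t f - G.dirichletSemigroup t f) 1
        G.measure) atTop (𝓝 0)) :
    G.dirichletSemigroup t (fun _ => 1) = fun _ => 1 := by
  funext y
  have hmem : MemLp (G.delta y) 1 G.measure := by
    refine ⟨G.aestronglyMeasurable_measure _, ?_⟩
    rw [eLpNorm_one_eq_tsum, tsum_eq_single y fun x hx => by
      rw [G.delta_of_ne hx, enorm_zero, mul_zero], delta_self]
    simp
  have hd : G.dirichletSemigroup t (G.delta y) = G.dirichletSemigroupL2 t (G.delta y) := by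
    funext x
    rw [dirichletSemigroup, tsum_eq_single y fun z hz => by rw [G.delta_of_ne hz, zero_mul],
      delta_self, one_mul]
  have hlim := h _ hmem
  rw [hd] at hlim
  set w : X → ℝ := ⇑(G.dirichletSemigroupL2 t (G.delta y)) with hw
  -- The norm of the Neumann approximants is exactly `m y` once `y` lies in `K k`, and the triangle
  -- inequality passes this to the limit.
  have hge : ENNReal.ofReal (G.m y) ≤ eLpNorm w 1 G.measure := by
    have h2 := hlim.add_const (eLpNorm w 1 G.measure)
    rw [zero_add] at h2
    refine ge_of_tendsto h2 ?_
    obtain ⟨j, hj⟩ := hK y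
    filter_upwards [eventually_ge_atTop j] with k hk
    rw [← G.eLpNorm_neumannRestriction_delta (K k) ht (hmono hk hj)]
    have h3 := eLpNorm_add_le (p := 1) (μ := G.measure) (G.aestronglyMeasurable_measure
      (G.neumannRestriction (K k) t (G.delta y) - w)) (G.aestronglyMeasurable_measure w) le_rfl
    rwa [sub_add_cancel] at h3
  have hs := G.hasSum_m_mul_dirichletSemigroupL2_delta ht y
  have e : ∀ x, G.m x * |w x| = G.m x * w x := fun x => by
    rw [abs_of_nonneg (G.dirichletSemigroupL2_delta_nonneg ht x y)]
  rw [G.eLpNorm_one_eq_ofReal (by simpa only [e] using hs.summable)] at hge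
  simp only [e] at hge
  have h1 := hs.tsum_eq
  rw [← hw] at h1
  rw [h1] at hge
  have hm := G.m_pos y
  have h0 : 0 ≤ G.m y * G.dirichletSemigroup t (fun _ => 1) y :=
    hs.nonneg fun x => mul_nonneg (G.m_pos x).le (G.dirichletSemigroupL2_delta_nonneg ht x y)
  rw [ENNReal.ofReal_le_ofReal_iff h0] at hge
  exact le_antisymm (G.dirichletSemigroup_one_le_one ht y) (le_of_mul_le_mul_left (by linarith) hm)

end Convergence

end WeightedGraph

end

/-- For a connected graph `b` over `(X, m)`, an exhaustion `K` and a time `t > 0`, stochastic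
completeness (`P_s 1 = 1` for all `s > 0`, equivalently for some `s > 0`) is equivalent to the
strong convergence in `ℓ¹(X, m)` of the Neumann restrictions of the semigroup at time `t` to the
Dirichlet semigroup at time `t`. -/
theorem mainTheorem3 {X : Type*} [Countable X] [MeasurableSpace X] [DiscreteMeasurableSpace X]
    (G : WeightedGraph X) (hG : G.Connected) (K : ℕ → Finset X) (hK : G.IsExhaustion K)
    (t : ℝ) (ht : 0 < t) :
    List.TFAE [
      ∀ s : ℝ, 0 < s → G.dirichletSemigroup s (fun _ => 1) = fun _ => 1,
      ∃ s : ℝ, 0 < s ∧ G.dirichletSemigroup s (fun _ => 1) = fun _ => 1,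
      ∀ f : X → ℝ, MemLp f 1 G.measure →
        Tendsto (fun k => eLpNorm (G.neumannRestriction (K k) t f - G.dirichletSemigroup t f) 1
          G.measure) atTop (𝓝 0)] := by
  have hmono : Monotone K := monotone_nat_of_le_succ hK.mono
  tfae_have 1 → 3 := fun h f hf =>
    WeightedGraph.tendsto_eLpNorm_sub hmono hK.exhausts ht (h t ht) hf
  tfae_have 3 → 2 := fun h =>
    ⟨t, ht, WeightedGraph.dirichletSemigroup_one_of_tendsto hmono hK.exhausts ht h⟩
  tfae_have 2 → 1 := by
    rintro ⟨s, hs, h⟩ r hr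
    rw [G.dirichletSemigroup_one_eq_iff hs] at h
    exact (G.dirichletSemigroup_one_eq_iff hr).2 (G.tsum_heat_eq_one_of_exists hs h hr)
  tfae_finish
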